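/- **Notation.** For a natural number $n$, let $\mathbb{M}_n^+$ be the set of positive semidefinite complex $n\times n$ matrices; $B>0$ means that $B$ is positive definite. For $X,Y\in\mathbb{M}_n^+$, the log-majorization $X\prec_{\log}Y$ means that $$\prod_{i=1}^k\lambda_i(X)\le\prod_{i=1}^k\lambda_i(Y)\qquad(k=1,\dots,n)$$ with equality for $k=n$, where $\lambda_1(\cdot)\ge\dots\ge\lambda_n(\cdot)$ are the eigenvalues in decreasing order counted with multiplicity. For $\alpha,z>0$ and $A,B\in\mathbb{M}_n^+$ with $B>0$ put $$P_\alpha(A,B)=B^{1/2}\bigl(B^{-1/2}AB^{-1/2}\bigr)^{\alpha}B^{1/2},\qquad Q_{\alpha,z}(A,B)=\Bigl(B^{\frac{1-\alpha}{2z}}A^{\frac{\alpha}{z}}B^{\frac{1-\alpha}{2z}}\Bigr)^{z}.$$ **Theorem 4.1.** Let $\alpha,z>0$ with $\alpha\ne1$. (a) The following conditions are equivalent: (i) $P_\alpha(A,B)\prec_{\log}Q_{\alpha,z}(A,B)$ for all $n\in\mathbb{N}$ and all $A,B\in\mathbb{M}_n^+$ with $B>0$; (ii) $\operatorname{Tr}P_\alpha(A,B)\le\operatorname{Tr}Q_{\alpha,z}(A,B)$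 for all $n\in\mathbb{N}$ and all $A,B\in\mathbb{M}_n^+$ with $B>0$; (iii) $P_\alpha(A,B)\prec_{\log}Q_{\alpha,z}(A,B)$ for all $A,B\in\mathbb{M}_2^+$ with $A,B>0$; (iv) either $0<\alpha<1$ (and $z>0$ is arbitrary), or $\alpha>1$ and $z\le\min\{\alpha/2,\alpha-1\}$. (b) The following conditions are equivalent: (i)$'$ $Q_{\alpha,z}(A,B)\prec_{\log}P_\alpha(A,B)$ for all $n\in\mathbb{N}$ and all $A,B\in\mathbb{M}_n^+$ with $B>0$; (ii)$'$ $\operatorname{Tr}Q_{\alpha,z}(A,B)\le\operatorname{Tr}P_\alpha(A,B)$ for all $n\in\mathbb{N}$ and all $A,B\in\mathbb{M}_n^+$ with $B>0$; (iii)$'$ $Q_{\alpha,z}(A,B)\prec_{\log}P_\alpha(A,B)$ for all $A,B\in\mathbb{M}_2^+$ with $A,B>0$; (iv)$'$ $\alpha>1$ and $z\ge\max\{\alpha/2,\alpha-1\}$. -/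

import Mathlib

open scoped ComplexOrder MatrixOrder

noncomputable section

/-- Log-majorization of `X` by `Y`, written `X ≺_log Y`, of positive semidefinite complex `n × n` matrices.
Positive semidefiniteness of both matrices is part of the assertion. Here `eigenvalues₀` lists
the eigenvalues of a Hermitian matrix, with multiplicities, in decreasing order, so the products
run over the `k` largest eigenvalues. -/
def LogMajorized {n : ℕ} (X Y : Matrix (Fin n) (Fin n) ℂ) : Prop :=
  ∃ (hX : X.PosSemidef) (hY : Y.PosSemidef),
    (∀ k : ℕ, 1 ≤ k → k ≤ n →
      ∏ i with i.val < k, hX.isHermitian.eigenvalues₀ i ≤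
        ∏ i with i.val < k, hY.isHermitian.eigenvalues₀ i) ∧
    ∏ i, hX.isHermitian.eigenvalues₀ i = ∏ i, hY.isHermitian.eigenvalues₀ i

/-- `P_α(A, B) = B^{1/2} (B^{-1/2} A B^{-1/2})^α B^{1/2}`. The real powers are those of the
continuous functional calculus. -/
def renyiP {n : ℕ} (α : ℝ) (A B : Matrix (Fin n) (Fin n) ℂ) : Matrix (Fin n) (Fin n) ℂ :=
  B ^ (1 / 2 : ℝ) * (B ^ (-(1 / 2) : ℝ) * A * B ^ (-(1 / 2) : ℝ)) ^ α * B ^ (1 / 2 : ℝ)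

/-- `Q_{α,z}(A, B) = (B^{(1-α)/(2z)} A^{α/z} B^{(1-α)/(2z)})^z`. The real powers are those of the
continuous functional calculus. -/
def renyiQ {n : ℕ} (α z : ℝ) (A B : Matrix (Fin n) (Fin n) ℂ) : Matrix (Fin n) (Fin n) ℂ :=
  (B ^ ((1 - α) / (2 * z)) * A ^ (α / z) * B ^ ((1 - α) / (2 * z))) ^ z

end

/-! Sufficiency rests on the antisymmetric tensor power trick. The `k`-th compound is multiplicative
and commutes with adjoints and, on positive matrices, with real powers (`compound_rpow`), so it
carries P and Q of (A, B) to P and Q of the compounds. By `norm_compound` its norm on a positive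
matrix is the product of the `k` largest eigenvalues. Log-majorization thus reduces to comparing
operator norms, together with det P = det Q = (det A)^α (det B)^(1-α). Both expressions are
homogeneous of degree α in A, so ‖P‖ ≤ ‖Q‖ follows from "Q ≤ 1 implies P ≤ 1": a^(α/z) ≤ b^((α-1)/z)
must imply (b^(-1/2) a b^(-1/2))^α ≤ b⁻¹. Part (b) needs the converse implication. The tools are the
Löwner–Heinz inequality, the polar identity `rpow_star_mul_self`, Furuta's inequality when α < 1 and
α ≤ z, and an iteration raising the exponent by 2 when α ≥ 2. For necessity, log-majorization gives
the trace inequality, which is tested on 2 × 2 matrices. Continuity allows a singular A: a rank-one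
projection turns the traces into weighted means of powers, and strict convexity or concavity
compares z with α - 1. When α > 1 it also allows R = B⁻¹ to be singular: for a rank-one R and A =
diag(1, t), suitable large t and small weight compare z with α/2. -/

/-! ### Real powers and operator inequalities in a C⋆-algebra. -/

section CStar

variable {𝒜 : Type*} [CStarAlgebra 𝒜] [PartialOrder 𝒜] [StarOrderedRing 𝒜]

/-- Conjugation by a unitary commutes with real powers. -/
lemma rpow_unitary_conj (u : unitary 𝒜) {a : 𝒜} (ha : IsStrictlyPositive a) (p : ℝ) :
    ((u : 𝒜) * a * star (u : 𝒜)) ^ p = (u : 𝒜) * a ^ p * star (u : 𝒜) := by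
  have hc : ContinuousOn (fun x : ℝ => x ^ p) (spectrum ℝ a) := fun x hx =>
    (Real.continuousAt_rpow_const x p
      (.inl ((StarOrderedRing.isStrictlyPositive_iff_spectrum_pos a).mp ha x hx).ne')
      ).continuousWithinAt
  have hn : 0 ≤ (u : 𝒜) * a * star (u : 𝒜) := star_right_conjugate_nonneg ha.nonneg _
  have hsa : IsSelfAdjoint a := ha.isSelfAdjoint
  have h := StarAlgHomClass.map_cfc (Unitary.conjStarAlgAut ℝ 𝒜 u) (fun x : ℝ => x ^ p) a hc
    (by
      change Continuous fun x : 𝒜 => (u : 𝒜) * x * star (u : 𝒜)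
      fun_prop) hsa
    (by simpa [Unitary.conjStarAlgAut_apply] using IsSelfAdjoint.of_nonneg hn)
  rw [CFC.rpow_eq_cfc_real hn, CFC.rpow_eq_cfc_real ha.nonneg]
  simpa [Unitary.conjStarAlgAut_apply] using h.symm

lemma isStrictlyPositive_star_mul_self {t : 𝒜} (ht : IsUnit t) : IsStrictlyPositive (star t * t) :=
  CStarAlgebra.isStrictlyPositive_iff_eq_star_mul_self.mpr ⟨t, ht, rfl⟩

/-- Polar decomposition of an invertible element. -/
lemma exists_unitary_mul_rpow_half {t : 𝒜} (ht : IsUnit t) :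
    ∃ u : unitary 𝒜, t = (u : 𝒜) * (star t * t) ^ (1 / 2 : ℝ) := by
  have hs := isStrictlyPositive_star_mul_self ht
  have h1 : IsSelfAdjoint ((star t * t) ^ (-(1 / 2) : ℝ)) := (hs.rpow _ _).isSelfAdjoint
  have hl : star (t * (star t * t) ^ (-(1 / 2) : ℝ)) * (t * (star t * t) ^ (-(1 / 2) : ℝ)) = 1 := by
    rw [star_mul, h1.star_eq, ← CFC.conjugate_rpow_neg_one_half (star t * t) hs]
    simp only [mul_assoc]
  have hu : IsUnit (t * (star t * t) ^ (-(1 / 2) : ℝ)) := ht.mul (hs.rpow _ _).isUnit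
  refine ⟨⟨_, Unitary.mem_iff.mpr ⟨hl, ?_⟩⟩, ?_⟩
  · obtain ⟨v, hv⟩ := hu
    rw [← hv] at hl ⊢
    rw [Units.eq_inv_of_mul_eq_one_right hl, Units.mul_inv]
  · change t = t * (star t * t) ^ (-(1 / 2) : ℝ) * (star t * t) ^ (1 / 2 : ℝ)
    rw [mul_assoc, CFC.rpow_neg_mul_rpow (1 / 2 : ℝ) hs, mul_one]

/-- By polar decomposition t t⋆ is a unitary conjugate of t⋆ t, so their powers are intertwined. The
identity lowers an exponent by one, which brings it into the range of the Löwner–Heinz inequality.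
-/
lemma rpow_star_mul_self {t : 𝒜} (ht : IsUnit t) (p : ℝ) :
    (star t * t) ^ p = star t * (t * star t) ^ (p - 1) * t := by
  obtain ⟨u, hu⟩ := exists_unitary_mul_rpow_half ht
  have hs := isStrictlyPositive_star_mul_self ht
  set s := star t * t with hsdef
  have h1 : IsSelfAdjoint (s ^ (1 / 2 : ℝ)) := (hs.rpow _ _).isSelfAdjoint
  have hst : star t = s ^ (1 / 2 : ℝ) * star (u : 𝒜) := by
    conv_lhs => rw [hu]
    rw [star_mul, h1.star_eq]
  have h2 : t * star t = (u : 𝒜) * s * star (u : 𝒜) := by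
    rw [hst]
    conv_lhs => rw [hu]
    rw [mul_assoc, ← mul_assoc (s ^ (1 / 2 : ℝ)), ← CFC.rpow_add hs.isUnit, mul_assoc]
    norm_num [CFC.rpow_one s hs.nonneg]
  rw [h2, rpow_unitary_conj u hs, hst]
  conv_rhs => rw [hu]
  have e1 : star (u : 𝒜) * (u : 𝒜) = 1 := Unitary.coe_star_mul_self u
  have : s ^ (1 / 2 : ℝ) * star (u : 𝒜) * (u * s ^ (p - 1) * star (u : 𝒜)) * (u * s ^ (1 / 2 : ℝ))
    = s ^ (1 / 2 : ℝ) * (star (u : 𝒜) * u) * s ^ (p - 1) * (star (u : 𝒜) * u) * s ^ (1 / 2 : ℝ) := by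
    noncomm_ring
  rw [this, e1, mul_one, mul_one, ← CFC.rpow_add hs.isUnit, ← CFC.rpow_add hs.isUnit]
  congr 1; ring

/-- Löwner–Heinz for the exponent -p, followed by antitonicity of the inverse. -/
lemma rpow_le_rpow_of_neg_exponent {a b : 𝒜} (ha : IsStrictlyPositive a) (hab : a ≤ b) {p : ℝ}
    (hp : -1 ≤ p) (hp0 : p ≤ 0) : b ^ p ≤ a ^ p := by
  rcases hp0.eq_or_lt with rfl | hp0
  · rw [CFC.rpow_zero a ha.nonneg, CFC.rpow_zero b (ha.nonneg.trans hab)]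
  have hb := ha.of_le hab
  have h := CStarAlgebra.rpow_neg_one_le_rpow_neg_one
    (CFC.rpow_le_rpow (p := -p) ⟨by linarith, by linarith⟩ hab) (ha.rpow _ _)
  rwa [CFC.rpow_rpow _ _ _ (by linarith) hb, CFC.rpow_rpow _ _ _ (by linarith) ha,
    mul_neg_one, neg_neg] at h

lemma rpow_smul {a : 𝒜} (ha : 0 ≤ a) {t p : ℝ} (ht : 0 ≤ t) (hp : 0 ≤ p) :
    (t • a) ^ p = t ^ p • a ^ p := by
  have h2 : 0 ≤ t • a := smul_nonneg ht ha
  rw [CFC.rpow_eq_cfc_real h2, CFC.rpow_eq_cfc_real ha]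
  have hc : Continuous fun x : ℝ => x ^ p := Real.continuous_rpow_const hp
  rw [← cfc_comp_smul t (fun x : ℝ => x ^ p) a (hc.continuousOn), ← cfc_smul _ _ _ hc.continuousOn]
  refine cfc_congr fun x hx => ?_
  have hx0 : 0 ≤ x := spectrum_nonneg_of_nonneg ha hx
  simp [Real.mul_rpow ht hx0]

lemma continuousOn_rpow_nonneg {p : ℝ} (hp : 0 < p) :
    ContinuousOn (fun a : 𝒜 => a ^ p) {a | 0 ≤ a} := by
  lift p to NNReal using hp.le
  have := CFC.continuousOn_nnrpow (A := 𝒜) p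
  exact this.congr fun a ha => (CFC.nnrpow_eq_rpow (by exact_mod_cast hp)).symm

lemma rpow_rpow_of_isStrictlyPositive {a : 𝒜} (ha : IsStrictlyPositive a) (x y : ℝ) :
    (a ^ x) ^ y = a ^ (x * y) := by
  rcases eq_or_ne x 0 with rfl | hx
  · rw [CFC.rpow_zero a ha.nonneg, CFC.one_rpow, zero_mul, CFC.rpow_zero a ha.nonneg]
  · exact CFC.rpow_rpow a x y hx ha

lemma rpow_mul_rpow_mul_rpow {a : 𝒜} (ha : IsStrictlyPositive a) (x y w : ℝ) :
    a ^ x * a ^ y * a ^ w = a ^ (x + y + w) := by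
  rw [CFC.rpow_add ha.isUnit, CFC.rpow_add ha.isUnit]

lemma rpow_conj_le_rpow_conj {a b : 𝒜} (c : 𝒜) (x : ℝ) (hab : a ≤ b) :
    c ^ x * a * c ^ x ≤ c ^ x * b * c ^ x :=
  (IsSelfAdjoint.of_nonneg CFC.rpow_nonneg).conjugate_le_conjugate hab

lemma isStrictlyPositive_rpow_conj {a c : 𝒜} (ha : IsStrictlyPositive a)
    (hc : IsStrictlyPositive c) (x : ℝ) : IsStrictlyPositive (c ^ x * a * c ^ x) :=
  have h := hc.rpow c x
  (h.isUnit.mul ha.isUnit |>.mul h.isUnit).isStrictlyPositive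
    (IsSelfAdjoint.conjugate_nonneg ha.nonneg h.isSelfAdjoint)

/-- `(cˣ b²ʸ cˣ)ᵖ = cˣ bʸ (bʸ c²ˣ bʸ)ᵖ⁻¹ bʸ cˣ`. -/
lemma rpow_conj_rpow {b c : 𝒜} (hb : IsStrictlyPositive b) (hc : IsStrictlyPositive c)
    {x y x' y' : ℝ} (hx : x' = x + x) (hy : y' = y + y) (p : ℝ) :
    (c ^ x * b ^ y' * c ^ x) ^ p =
      c ^ x * (b ^ y * (b ^ y * c ^ x' * b ^ y) ^ (p - 1) * b ^ y) * c ^ x := by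
  have h1 : star (b ^ y) = b ^ y := (hb.rpow b y).isSelfAdjoint.star_eq
  have h2 : star (c ^ x) = c ^ x := (hc.rpow c x).isSelfAdjoint.star_eq
  have h := rpow_star_mul_self (t := b ^ y * c ^ x)
    ((hb.rpow b y).isUnit.mul (hc.rpow c x).isUnit) p
  rw [star_mul, h1, h2] at h
  rw [hx, hy, CFC.rpow_add hb.isUnit, CFC.rpow_add hc.isUnit]
  simp only [mul_assoc] at h ⊢
  exact h

/-! ### Furuta's inequality. -/

/-- The polar identity leaves the exponent (1 - p)/(p + r) in [-1, 0] on a^(p/2) b^r a^(p/2) ≥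
a^(p+r), so that power is at most a^(1-p). Conjugation then reduces the claim to a ≤ b. -/
lemma furuta_of_le_one {a b : 𝒜} (ha : IsStrictlyPositive a) (hab : a ≤ b) {p r : ℝ}
    (hp : 1 ≤ p) (hr : 0 ≤ r) (hr1 : r ≤ 1) :
    (b ^ (r / 2) * a ^ p * b ^ (r / 2)) ^ ((1 + r) / (p + r)) ≤ b ^ (1 + r) := by
  have hb := ha.of_le hab
  have hpr : 0 < p + r := by linarith
  rw [rpow_conj_rpow (y := p / 2) ha hb (add_halves r).symm (add_halves p).symm]
  have h1 : a ^ (p + r) ≤ a ^ (p / 2) * b ^ r * a ^ (p / 2) := by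
    have := rpow_conj_le_rpow_conj a (p / 2) (CFC.rpow_le_rpow ⟨hr, hr1⟩ hab)
    rwa [rpow_mul_rpow_mul_rpow ha, show p / 2 + r + p / 2 = p + r by ring] at this
  have h2 := rpow_le_rpow_of_neg_exponent (p := (1 + r) / (p + r) - 1) (ha.rpow _ _) h1
    (by rw [← sub_nonneg]; ring_nf; positivity)
    (by rw [sub_nonpos, div_le_one hpr]; linarith)
  rw [rpow_rpow_of_isStrictlyPositive ha,
    show (p + r) * ((1 + r) / (p + r) - 1) = 1 - p by field_simp; ring] at h2
  have h3 := rpow_conj_le_rpow_conj a (p / 2) h2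
  rw [rpow_mul_rpow_mul_rpow ha, show p / 2 + (1 - p) + p / 2 = 1 by ring,
    CFC.rpow_one a ha.nonneg] at h3
  refine (rpow_conj_le_rpow_conj b (r / 2) (h3.trans hab)).trans_eq ?_
  nth_rw 2 [← CFC.rpow_one b hb.nonneg]
  rw [rpow_mul_rpow_mul_rpow hb]
  congr 1; ring

/-- Furuta's inequality. -/
theorem furuta {a b : 𝒜} (ha : IsStrictlyPositive a) (hab : a ≤ b) {p r : ℝ}
    (hp : 1 ≤ p) (hr : 0 ≤ r) :
    (b ^ (r / 2) * a ^ p * b ^ (r / 2)) ^ ((1 + r) / (p + r)) ≤ b ^ (1 + r) := by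
  have hb := ha.of_le hab
  obtain ⟨n, hn⟩ := exists_nat_ge r
  induction n generalizing r with
  | zero => exact furuta_of_le_one ha hab hp hr (by push_cast at hn; linarith)
  | succ n ih =>
    rcases le_total r 1 with hr1 | hr1
    · exact furuta_of_le_one ha hab hp hr hr1
    push_cast at hn
    -- The bound for s reads d^((1+s)/(p+s)) ≤ b^(1+s). The case r = 1, applied to this pair with
    -- exponent (p+s)/(1+s), restores d and adds (1+s)/2 to the outer exponent s/2, giving (2s+1)/2.
    obtain ⟨s, rfl⟩ : ∃ s, r = 2 * s + 1 := ⟨(r - 1) / 2, by ring⟩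
    have hs : 0 ≤ s := by linarith
    have hps : 0 < p + s := by linarith
    have h1 := ih hs (by linarith)
    have hd : IsStrictlyPositive (b ^ (s / 2) * a ^ p * b ^ (s / 2)) :=
      isStrictlyPositive_rpow_conj (ha.rpow _ _) hb _
    have h2 := furuta_of_le_one (p := (p + s) / (1 + s)) (r := 1) (hd.rpow _ _) h1
      (by rw [le_div_iff₀ (by linarith)]; linarith) zero_le_one le_rfl
    rw [rpow_rpow_of_isStrictlyPositive hd,
      show (1 + s) / (p + s) * ((p + s) / (1 + s)) = 1 by field_simp,
      CFC.rpow_one _ hd.nonneg, rpow_rpow_of_isStrictlyPositive hb,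
      rpow_rpow_of_isStrictlyPositive hb] at h2
    have e1 : ∀ X : 𝒜, b ^ ((1 + s) * (1 / 2)) * (b ^ (s / 2) * X * b ^ (s / 2)) *
        b ^ ((1 + s) * (1 / 2)) = b ^ ((2 * s + 1) / 2) * X * b ^ ((2 * s + 1) / 2) := by
      intro X
      conv_rhs =>
        rw [show (2 * s + 1) / 2 = (1 + s) * (1 / 2) + s / 2 by ring, CFC.rpow_add hb.isUnit]
        arg 2
        rw [← CFC.rpow_add hb.isUnit, add_comm, CFC.rpow_add hb.isUnit]
      simp only [mul_assoc]
    rw [e1] at h2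
    convert h2 using 2
    · field_simp; ring
    · ring

/-- The hypothesis, raised to the power -x/s, bounds the left side by a^(2(1 - x/s)) = (a²)^(y/s).
Raised to the power y/s, it bounds this by the right side. -/
lemma mul_rpow_mul_le_rpow {a e : 𝒜} (ha : IsStrictlyPositive a) (he : IsStrictlyPositive e)
    {s x y : ℝ} (hs : 0 < s) (h : a ^ (2 : ℝ) ≤ e ^ (2 * s)) (hx : 0 ≤ x) (hy : 0 ≤ y)
    (hxy : x + y = s) : a * e ^ (-(2 * x)) * a ≤ e ^ (2 * y) := by
  have ht : x / s ≤ 1 := by rw [div_le_one hs]; linarith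
  have ht0 : 0 ≤ x / s := by positivity
  have h1 := rpow_le_rpow_of_neg_exponent (p := -(x / s)) (ha.rpow _ _) h (by linarith)
    (by linarith)
  have h2 := CFC.rpow_le_rpow (p := 1 - x / s) ⟨by linarith, by linarith⟩ h
  rw [rpow_rpow_of_isStrictlyPositive he, rpow_rpow_of_isStrictlyPositive ha] at h1 h2
  have h3 := rpow_conj_le_rpow_conj a 1 h1
  rw [rpow_mul_rpow_mul_rpow ha, CFC.rpow_one a ha.nonneg,
    show 1 + 2 * -(x / s) + 1 = 2 * (1 - x / s) by ring] at h3
  have h4 := h3.trans h2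
  rwa [show 2 * s * -(x / s) = -(2 * x) by field_simp,
    show 2 * s * (1 - x / s) = 2 * y by rw [← hxy] at hs ⊢; field_simp; ring] at h4

/-- If `a² ≤ e²⁽ˢ⁻¹⁾` and `s ≥ 2`, then `(e⁻ˢᐟ² a e⁻ˢᐟ²)ˢ ≤ e⁻ˢ`. -/
lemma rpow_conj_rpow_le_of_two_le {a e : 𝒜} (ha : IsStrictlyPositive a)
    (he : IsStrictlyPositive e) {s : ℝ} (hs : 2 ≤ s)
    (h : a ^ (2 : ℝ) ≤ e ^ (2 * (s - 1))) :
    (e ^ (-(s / 2)) * a * e ^ (-(s / 2))) ^ s ≤ e ^ (-s) := by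
  have hd : IsStrictlyPositive (e ^ (-(s / 2)) * a * e ^ (-(s / 2))) :=
    isStrictlyPositive_rpow_conj ha he _
  set d := e ^ (-(s / 2)) * a * e ^ (-(s / 2)) with hdd
  -- Here d e^c d = e^(-s/2) (a e^(c-s) a) e^(-s/2), and the middle factor is at most e^(s-2+c). The
  -- lower bound on c keeps that exponent nonnegative.
  have step : ∀ c, 2 - s ≤ c → c ≤ 0 → d * e ^ c * d ≤ e ^ (c - 2) := by
    intro c hc hc0
    have h1 := rpow_conj_le_rpow_conj e (-(s / 2)) (mul_rpow_mul_le_rpow ha he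
      (x := (s - c) / 2) (y := (s - 2 + c) / 2) (by linarith) h (by linarith) (by linarith)
      (by ring))
    rw [rpow_mul_rpow_mul_rpow he] at h1
    refine le_of_eq_of_le ?_ (h1.trans_eq ?_)
    · rw [show -(2 * ((s - c) / 2)) = -(s / 2) + c + -(s / 2) by ring,
        ← rpow_mul_rpow_mul_rpow he]
      simp only [hdd, mul_assoc]
    · congr 1; ring
  have h2 : d ^ (2 : ℝ) ≤ e ^ (-2 : ℝ) := by
    have := step 0 (by linarith) le_rfl
    rw [CFC.rpow_zero e he.nonneg, mul_one, zero_sub] at this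
    rwa [show (2 : ℝ) = 1 + 1 by norm_num, CFC.rpow_add hd.isUnit, CFC.rpow_one d hd.nonneg,
      show (-(1 + 1) : ℝ) = -2 by norm_num]
  -- Multiplying by d on both sides raises the exponent by 2: d^(t+2) ≤ d e^(-t) d ≤ e^(-t-2). The
  -- start t ∈ [0, 2] comes from d² ≤ e⁻².
  have main : ∀ (n : ℕ) (t : ℝ), 0 ≤ t → t ≤ 2 → t + 2 * n ≤ s →
      d ^ (t + 2 * n) ≤ e ^ (-(t + 2 * n)) := by
    intro n t ht ht2
    induction n with
    | zero =>
      intro _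
      have := CFC.rpow_le_rpow (p := t / 2) ⟨by linarith, by linarith⟩ h2
      rw [rpow_rpow_of_isStrictlyPositive he, rpow_rpow_of_isStrictlyPositive hd] at this
      convert this using 2 <;> push_cast <;> ring
    | succ n ih =>
      intro hn
      push_cast at hn
      have hn0 : (0 : ℝ) ≤ n := n.cast_nonneg
      have h3 := rpow_conj_le_rpow_conj d 1 (ih (by linarith))
      rw [rpow_mul_rpow_mul_rpow hd, CFC.rpow_one d hd.nonneg] at h3
      have h4 := h3.trans (step _ (by linarith) (by linarith))
      convert h4 using 2 <;> push_cast <;> ring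
  have hf : (⌊s / 2⌋₊ : ℝ) ≤ s / 2 := Nat.floor_le (by linarith)
  have hf' : s / 2 < ⌊s / 2⌋₊ + 1 := Nat.lt_floor_add_one _
  have := main ⌊s / 2⌋₊ (s - 2 * ⌊s / 2⌋₊) (by linarith) (by linarith) (by linarith)
  rwa [sub_add_cancel] at this

/-! ### The implications between Q ≤ 1 and P ≤ 1. -/

section LoewnerImplications

variable {a b : 𝒜} {α z : ℝ}

lemma geometric_rpow_le_of_lt_one (ha : IsStrictlyPositive a) (hb : IsStrictlyPositive b)
    (hα : 0 < α) (hα1 : α < 1) (hz : 0 < z) (h : a ^ (α / z) ≤ b ^ ((α - 1) / z)) :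
    (b ^ (-(1 / 2) : ℝ) * a * b ^ (-(1 / 2) : ℝ)) ^ α ≤ b ^ (-1 : ℝ) := by
  have h1α : 0 < 1 - α := by linarith
  rcases le_total α z with hαz | hαz
  · have hd : IsStrictlyPositive (b ^ (-(1 / 2) : ℝ) * a * b ^ (-(1 / 2) : ℝ)) :=
      isStrictlyPositive_rpow_conj ha hb _
    -- Chosen so that (b^((α-1)/z))^(r/2) = b^(-1/2); with p = z/α, Furuta's inequality then
    -- involves b^(-1/2) a b^(-1/2) itself.
    set r := z / (1 - α) with hr
    have hr0 : 0 < r := by positivity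
    have h1 := furuta (ha.rpow _ _) h (p := z / α) (r := r)
      (by rw [le_div_iff₀ hα]; linarith) hr0.le
    rw [rpow_rpow_of_isStrictlyPositive ha, rpow_rpow_of_isStrictlyPositive hb,
      show α / z * (z / α) = 1 by field_simp, CFC.rpow_one a ha.nonneg,
      show (α - 1) / z * (r / 2) = -(1 / 2) by rw [hr]; field_simp; ring] at h1
    have h2 := CFC.rpow_le_rpow (p := r / (1 + r))
      ⟨by positivity, by rw [div_le_one (by positivity)]; linarith⟩ h1
    rw [rpow_rpow_of_isStrictlyPositive hd, rpow_rpow_of_isStrictlyPositive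
      (hb.rpow _ _), rpow_rpow_of_isStrictlyPositive hb] at h2
    have e1 : (1 + r) / (z / α + r) * (r / (1 + r)) = α := by
      have : z / α + r = r / α := by rw [hr]; field_simp; ring
      rw [this]; field_simp
    have e2 : (α - 1) / z * ((1 + r) * (r / (1 + r))) = -1 := by
      have : (1 + r) * (r / (1 + r)) = r := by field_simp
      rw [this, hr]; field_simp; ring
    rwa [e1, e2] at h2
  · have h1 := CFC.rpow_le_rpow (p := z / α) ⟨by positivity, by rwa [div_le_one hα]⟩ h
    rw [rpow_rpow_of_isStrictlyPositive ha, rpow_rpow_of_isStrictlyPositive hb,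
      show α / z * (z / α) = 1 by field_simp, CFC.rpow_one a ha.nonneg] at h1
    have h2 := rpow_conj_le_rpow_conj b (-(1 / 2)) h1
    rw [rpow_mul_rpow_mul_rpow hb] at h2
    have h3 := CFC.rpow_le_rpow (p := α) ⟨hα.le, hα1.le⟩ h2
    rwa [rpow_rpow_of_isStrictlyPositive hb,
      show (-(1 / 2) + (α - 1) / z * (z / α) + -(1 / 2)) * α = -1 by field_simp; ring] at h3

lemma geometric_rpow_le_of_one_lt (ha : IsStrictlyPositive a) (hb : IsStrictlyPositive b)
    (hα : 1 < α) (hz : 0 < z) (hz1 : z ≤ α / 2) (hz2 : z ≤ α - 1)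
    (h : a ^ (α / z) ≤ b ^ ((α - 1) / z)) :
    (b ^ (-(1 / 2) : ℝ) * a * b ^ (-(1 / 2) : ℝ)) ^ α ≤ b ^ (-1 : ℝ) := by
  have hα0 : 0 < α := by linarith
  have hα1 : 0 < α - 1 := by linarith
  rcases le_total α 2 with hα2 | hα2
  -- For α ≤ 2, z ≤ α - 1 gives b⁻¹ ≤ a^(-α/(α-1)). The polar identity leaves the power α - 1 ≤ 1 of
  -- a^(1/2) b⁻¹ a^(1/2), which is at most a⁻¹.
  · have h1 := rpow_le_rpow_of_neg_exponent (p := -(z / (α - 1))) (ha.rpow _ _) h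
      (by rw [neg_le_neg_iff, div_le_one hα1]; exact hz2) (by simp only [neg_nonpos]; positivity)
    rw [rpow_rpow_of_isStrictlyPositive ha, rpow_rpow_of_isStrictlyPositive hb,
      show (α - 1) / z * -(z / (α - 1)) = -1 by field_simp] at h1
    have h2 := rpow_conj_le_rpow_conj a (1 / 2) h1
    rw [rpow_mul_rpow_mul_rpow ha] at h2
    have h3 := CFC.rpow_le_rpow (p := α - 1) ⟨by linarith, by linarith⟩ h2
    rw [rpow_rpow_of_isStrictlyPositive ha,
      show (1 / 2 + α / z * -(z / (α - 1)) + 1 / 2) * (α - 1) = -1 by field_simp; ring] at h3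
    have h4 := rpow_conj_le_rpow_conj a (1 / 2) h3
    rw [rpow_mul_rpow_mul_rpow ha, show (1 / 2 + -1 + 1 / 2 : ℝ) = 0 by norm_num,
      CFC.rpow_zero a ha.nonneg] at h4
    have h5 := rpow_conj_le_rpow_conj b (-(1 / 2)) h4
    have e := rpow_conj_rpow ha hb (x := -(1 / 2)) (y := 1 / 2) (x' := -1) (y' := 1)
      (by norm_num) (by norm_num) α
    rw [CFC.rpow_one a ha.nonneg] at e
    rw [e]
    refine h5.trans_eq ?_
    rw [mul_one, ← CFC.rpow_add hb.isUnit]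
    norm_num
  -- For α ≥ 2, z ≤ α/2 gives a² ≤ b^(2(α-1)/α), the hypothesis of the iterated bound with e =
  -- b^(1/α) and s = α.
  · have he := hb.rpow b (1 / α)
    have h1 := CFC.rpow_le_rpow (p := 2 * z / α)
      ⟨by positivity, by rw [div_le_one hα0]; linarith⟩ h
    rw [rpow_rpow_of_isStrictlyPositive ha, rpow_rpow_of_isStrictlyPositive hb,
      show α / z * (2 * z / α) = 2 by field_simp,
      show (α - 1) / z * (2 * z / α) = 1 / α * (2 * (α - 1)) by field_simp,
      ← rpow_rpow_of_isStrictlyPositive hb] at h1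
    have h2 := rpow_conj_rpow_le_of_two_le ha he hα2 h1
    rwa [rpow_rpow_of_isStrictlyPositive hb, rpow_rpow_of_isStrictlyPositive hb,
      show 1 / α * -(α / 2) = -(1 / 2) by field_simp, show 1 / α * -α = -1 by field_simp] at h2

/-- With d = b^(-1/2) a b^(-1/2), the hypothesis inverts to b ≤ d^(-α). The polar identity writes
a^(α/z) through the power α/z - 1 of d^(1/2) b d^(1/2) ≤ d^(1-α). The bounds on z place this
exponent and the final 1 - (α-1)/z in [0, 1]. -/
lemma rpow_le_of_geometric_rpow_le_of_le (ha : IsStrictlyPositive a) (hb : IsStrictlyPositive b)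
    (hα : 1 < α) (hz1 : α / 2 ≤ z) (hz2 : α - 1 ≤ z) (hz3 : z ≤ α)
    (h : (b ^ (-(1 / 2) : ℝ) * a * b ^ (-(1 / 2) : ℝ)) ^ α ≤ b ^ (-1 : ℝ)) :
    a ^ (α / z) ≤ b ^ ((α - 1) / z) := by
  have hz : 0 < z := by linarith
  have hd : IsStrictlyPositive (b ^ (-(1 / 2) : ℝ) * a * b ^ (-(1 / 2) : ℝ)) :=
    isStrictlyPositive_rpow_conj ha hb _
  have hbd : b ^ (1 / 2 : ℝ) * (b ^ (-(1 / 2) : ℝ) * a * b ^ (-(1 / 2) : ℝ)) * b ^ (1 / 2 : ℝ)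
      = a := by
    rw [show b ^ (1 / 2 : ℝ) * (b ^ (-(1 / 2) : ℝ) * a * b ^ (-(1 / 2) : ℝ)) * b ^ (1 / 2 : ℝ)
      = (b ^ (1 / 2 : ℝ) * b ^ (-(1 / 2) : ℝ)) * a * (b ^ (-(1 / 2) : ℝ) * b ^ (1 / 2 : ℝ)) by
        simp only [mul_assoc], CFC.rpow_mul_rpow_neg _ hb, CFC.rpow_neg_mul_rpow _ hb, one_mul,
      mul_one]
  generalize b ^ (-(1 / 2) : ℝ) * a * b ^ (-(1 / 2) : ℝ) = d at h hd hbd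
  have h1 := rpow_le_rpow_of_neg_exponent (p := -1) (hd.rpow _ _) h le_rfl (by norm_num)
  rw [rpow_rpow_of_isStrictlyPositive hb, rpow_rpow_of_isStrictlyPositive hd,
    neg_one_mul, neg_neg, CFC.rpow_one b hb.nonneg] at h1
  have h2 := rpow_conj_le_rpow_conj d (1 / 2) h1
  rw [rpow_mul_rpow_mul_rpow hd] at h2
  have hq1 : 1 ≤ α / z := by rwa [one_le_div hz]
  have hq2 : α / z ≤ 2 := by rw [div_le_iff₀ hz]; linarith
  have h3 := CFC.rpow_le_rpow (p := α / z - 1) ⟨by linarith, by linarith⟩ h2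
  rw [rpow_rpow_of_isStrictlyPositive hd] at h3
  have h4 := rpow_conj_le_rpow_conj d (1 / 2) h3
  rw [rpow_mul_rpow_mul_rpow hd] at h4
  have ht : (α - 1) / z ≤ 1 := by rwa [div_le_one hz]
  have ht0 : 0 ≤ (α - 1) / z := div_nonneg (by linarith) hz.le
  have h5 := CFC.rpow_le_rpow (p := 1 - (α - 1) / z) ⟨by linarith, by linarith⟩ h
  rw [rpow_rpow_of_isStrictlyPositive hd, rpow_rpow_of_isStrictlyPositive hb] at h5
  rw [show 1 / 2 + (1 / 2 + α * -1 + 1 / 2) * (α / z - 1) + 1 / 2 = α * (1 - (α - 1) / z) by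
    field_simp; ring] at h4
  have h6 := rpow_conj_le_rpow_conj b (1 / 2) (h4.trans h5)
  have e := rpow_conj_rpow hd hb (x := 1 / 2) (y := 1 / 2) (x' := 1) (y' := 1)
      (by norm_num) (by norm_num) (α / z)
  rw [CFC.rpow_one d hd.nonneg, CFC.rpow_one b hb.nonneg, hbd] at e
  rw [e]
  refine h6.trans_eq ?_
  rw [rpow_mul_rpow_mul_rpow hb]
  congr 1; ring

lemma rpow_le_of_geometric_rpow_le (ha : IsStrictlyPositive a) (hb : IsStrictlyPositive b)
    (hα : 1 < α) (hz1 : α / 2 ≤ z) (hz2 : α - 1 ≤ z)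
    (h : (b ^ (-(1 / 2) : ℝ) * a * b ^ (-(1 / 2) : ℝ)) ^ α ≤ b ^ (-1 : ℝ)) :
    a ^ (α / z) ≤ b ^ ((α - 1) / z) := by
  rcases le_total z α with hz3 | hz3
  · exact rpow_le_of_geometric_rpow_le_of_le ha hb hα hz1 hz2 hz3 h
  have hα0 : 0 < α := by linarith
  have hz : 0 < z := by linarith
  have h1 := rpow_le_of_geometric_rpow_le_of_le (z := α) ha hb hα (by linarith) (by linarith)
    le_rfl h
  have h2 := CFC.rpow_le_rpow (p := α / z) ⟨by positivity, by rwa [div_le_one hz]⟩ h1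
  rwa [rpow_rpow_of_isStrictlyPositive ha, rpow_rpow_of_isStrictlyPositive hb,
    div_self hα0.ne', one_mul, show (α - 1) / α * (α / z) = (α - 1) / z by field_simp] at h2

end LoewnerImplications

end CStar

/-! ### From order implications to norm inequalities. -/

section CStarNorm

variable {𝒜 : Type*} [CStarAlgebra 𝒜] [PartialOrder 𝒜] [StarOrderedRing 𝒜]

/-- `P_α(a, b)` in a C⋆-algebra. -/
noncomputable def geomP (α : ℝ) (a b : 𝒜) : 𝒜 :=
  b ^ (1 / 2 : ℝ) * (b ^ (-(1 / 2) : ℝ) * a * b ^ (-(1 / 2) : ℝ)) ^ α * b ^ (1 / 2 : ℝ)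

/-- `Q_{α,z}(a, b)` in a C⋆-algebra. -/
noncomputable def sandwichQ (α z : ℝ) (a b : 𝒜) : 𝒜 :=
  (b ^ ((1 - α) / (2 * z)) * a ^ (α / z) * b ^ ((1 - α) / (2 * z))) ^ z

lemma rpow_conj_nonneg {a : 𝒜} (ha : 0 ≤ a) (c : 𝒜) (x : ℝ) : 0 ≤ c ^ x * a * c ^ x :=
  IsSelfAdjoint.conjugate_nonneg ha (IsSelfAdjoint.of_nonneg CFC.rpow_nonneg)

lemma geomP_nonneg (α : ℝ) (a b : 𝒜) : 0 ≤ geomP α a b :=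
  rpow_conj_nonneg CFC.rpow_nonneg _ _

lemma sandwichQ_nonneg (α z : ℝ) (a b : 𝒜) : 0 ≤ sandwichQ α z a b := CFC.rpow_nonneg

lemma geomP_smul {α t : ℝ} (hα : 0 ≤ α) (ht : 0 ≤ t) {a : 𝒜} (ha : 0 ≤ a) (b : 𝒜) :
    geomP α (t • a) b = t ^ α • geomP α a b := by
  have h : 0 ≤ b ^ (-(1 / 2) : ℝ) * a * b ^ (-(1 / 2) : ℝ) := rpow_conj_nonneg ha _ _
  simp only [geomP, mul_smul_comm, smul_mul_assoc, rpow_smul h ht hα]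

lemma sandwichQ_smul {α z t : ℝ} (hα : 0 ≤ α) (hz : 0 < z) (ht : 0 ≤ t) {a : 𝒜} (ha : 0 ≤ a)
    (b : 𝒜) : sandwichQ α z (t • a) b = t ^ α • sandwichQ α z a b := by
  have h : 0 ≤ b ^ ((1 - α) / (2 * z)) * a ^ (α / z) * b ^ ((1 - α) / (2 * z)) :=
    rpow_conj_nonneg CFC.rpow_nonneg _ _
  rw [sandwichQ, rpow_smul ha ht (div_nonneg hα hz.le), mul_smul_comm, smul_mul_assoc,
    rpow_smul h (by positivity) hz.le, ← Real.rpow_mul ht, div_mul_cancel₀ _ hz.ne', sandwichQ]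

lemma continuousOn_geomP {α : ℝ} (hα : 0 < α) (b : 𝒜) :
    ContinuousOn (fun a => geomP α a b) {a | 0 ≤ a} := by
  have h : ContinuousOn (fun a => (b ^ (-(1 / 2) : ℝ) * a * b ^ (-(1 / 2) : ℝ)) ^ α)
      {a : 𝒜 | 0 ≤ a} :=
    (continuousOn_rpow_nonneg hα).comp (by fun_prop) fun a ha => rpow_conj_nonneg ha _ _
  exact (continuousOn_const.mul h).mul continuousOn_const

lemma continuousOn_sandwichQ {α z : ℝ} (hα : 0 < α) (hz : 0 < z) (b : 𝒜) :
    ContinuousOn (fun a => sandwichQ α z a b) {a | 0 ≤ a} := by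
  refine (continuousOn_rpow_nonneg hz).comp
    ((continuousOn_const.mul (continuousOn_rpow_nonneg (div_pos hα hz))).mul continuousOn_const)
    fun a _ => rpow_conj_nonneg CFC.rpow_nonneg _ _

lemma rpow_conj_le_one_iff {c : 𝒜} (hc : IsStrictlyPositive c) (a : 𝒜) (x : ℝ) :
    c ^ x * a * c ^ x ≤ 1 ↔ a ≤ c ^ (-(2 * x)) := by
  constructor <;> intro h
  · have := rpow_conj_le_rpow_conj c (-x) h
    rwa [mul_one, ← CFC.rpow_add hc.isUnit, ← neg_add, ← two_mul,
      show c ^ (-x) * (c ^ x * a * c ^ x) * c ^ (-x)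
        = (c ^ (-x) * c ^ x) * a * (c ^ x * c ^ (-x)) by simp only [mul_assoc],
      CFC.rpow_neg_mul_rpow x hc, CFC.rpow_mul_rpow_neg x hc, one_mul, mul_one] at this
  · have := rpow_conj_le_rpow_conj c x h
    rwa [rpow_mul_rpow_mul_rpow hc, show x + -(2 * x) + x = 0 by ring,
      CFC.rpow_zero c hc.nonneg] at this

lemma geomP_le_one_iff {α : ℝ} {a b : 𝒜} (hb : IsStrictlyPositive b) :
    geomP α a b ≤ 1 ↔ (b ^ (-(1 / 2) : ℝ) * a * b ^ (-(1 / 2) : ℝ)) ^ α ≤ b ^ (-1 : ℝ) := by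
  rw [geomP, rpow_conj_le_one_iff hb]
  norm_num

/-- Since ‖x^z‖ = ‖x‖^z, the outer power can be dropped for every z > 0, although x ↦ x^z need not
be operator monotone. -/
lemma sandwichQ_le_one_iff {α z : ℝ} (hz : 0 < z) {a b : 𝒜} (hb : IsStrictlyPositive b) :
    sandwichQ α z a b ≤ 1 ↔ a ^ (α / z) ≤ b ^ ((α - 1) / z) := by
  have h : 0 ≤ b ^ ((1 - α) / (2 * z)) * a ^ (α / z) * b ^ ((1 - α) / (2 * z)) :=
    rpow_conj_nonneg CFC.rpow_nonneg _ _
  have hz1 : ∀ x : ℝ, 0 ≤ x → (x ^ z ≤ 1 ↔ x ≤ 1) := fun x hx => by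
    simpa using Real.rpow_le_rpow_iff hx zero_le_one hz
  rw [← CStarAlgebra.norm_le_one_iff_of_nonneg _ (sandwichQ_nonneg α z a b), sandwichQ,
    CFC.norm_rpow _ hz h, hz1 _ (norm_nonneg _),
    CStarAlgebra.norm_le_one_iff_of_nonneg _ h, rpow_conj_le_one_iff hb]
  have : -(2 * ((1 - α) / (2 * z))) = (α - 1) / z := by field_simp; ring
  rw [this]

/-- For c > ‖f a‖, scaling a by c^(-1/α) makes f at most 1; then g is at most 1, which says ‖g a‖ ≤
c. -/
lemma norm_le_norm_of_homogeneous {f g : 𝒜 → 𝒜} {α : ℝ} (hα : 0 < α)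
    (hf : ∀ a, IsStrictlyPositive a → ∀ t : ℝ, 0 < t → f (t • a) = t ^ α • f a)
    (hg : ∀ a, IsStrictlyPositive a → ∀ t : ℝ, 0 < t → g (t • a) = t ^ α • g a)
    (hf0 : ∀ a, 0 ≤ f a) (hg0 : ∀ a, 0 ≤ g a)
    (h : ∀ a, IsStrictlyPositive a → f a ≤ 1 → g a ≤ 1) {a : 𝒜} (ha : IsStrictlyPositive a) :
    ‖g a‖ ≤ ‖f a‖ := by
  refine le_of_forall_gt_imp_ge_of_dense fun c hc => ?_
  have hc0 : 0 < c := (norm_nonneg _).trans_lt hc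
  have ht : 0 < c ^ (-(1 / α)) := by positivity
  have hta : IsStrictlyPositive (c ^ (-(1 / α)) • a) := by
    refine (IsUnit.isStrictlyPositive ?_ (smul_nonneg ht.le ha.nonneg))
    exact (ha.isUnit.smul (Units.mk0 _ ht.ne'))
  have key := h _ hta
  have hpow : (c ^ (-(1 / α))) ^ α = c⁻¹ := by
    rw [← Real.rpow_mul hc0.le, neg_mul, one_div_mul_cancel hα.ne', Real.rpow_neg_one]
  rw [← CStarAlgebra.norm_le_one_iff_of_nonneg _ (hf0 _),
    ← CStarAlgebra.norm_le_one_iff_of_nonneg _ (hg0 _), hf a ha _ ht, hg a ha _ ht, hpow,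
    norm_smul, norm_smul, Real.norm_of_nonneg (by positivity), inv_mul_le_iff₀ hc0,
    inv_mul_le_iff₀ hc0, mul_one] at key
  exact key hc.le

lemma le_of_le_on_isStrictlyPositive {f g : 𝒜 → ℝ} (hf : ContinuousOn f {a | 0 ≤ a})
    (hg : ContinuousOn g {a | 0 ≤ a}) (h : ∀ a, IsStrictlyPositive a → f a ≤ g a) {a : 𝒜}
    (ha : 0 ≤ a) : f a ≤ g a := by
  have hc : Continuous fun t : ℝ => a + t • (1 : 𝒜) := by fun_prop
  have ht : Filter.Tendsto (fun t : ℝ => a + t • (1 : 𝒜)) (nhdsWithin 0 (Set.Ioi 0))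
      (nhdsWithin a {a | 0 ≤ a}) := by
    refine tendsto_nhdsWithin_iff.mpr ⟨?_, ?_⟩
    · simpa using (hc.tendsto 0).mono_left nhdsWithin_le_nhds
    · filter_upwards [self_mem_nhdsWithin] with t ht
      exact add_nonneg ha (smul_nonneg (le_of_lt ht) zero_le_one)
  refine le_of_tendsto_of_tendsto ((hf a ha).tendsto.comp ht) ((hg a ha).tendsto.comp ht) ?_
  filter_upwards [self_mem_nhdsWithin] with t ht
  refine h _ (IsStrictlyPositive.nonneg_add ha ?_)
  have ht' : (0 : ℝ) < t := ht
  exact IsUnit.isStrictlyPositive (isUnit_one.smul (Units.mk0 t ht'.ne'))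
    (smul_nonneg ht'.le zero_le_one : (0 : 𝒜) ≤ t • 1)

theorem norm_geomP_le_norm_sandwichQ {α z : ℝ} (hα : 0 < α) (hz : 0 < z)
    (h : α < 1 ∨ 1 < α ∧ z ≤ min (α / 2) (α - 1)) {a b : 𝒜} (ha : 0 ≤ a)
    (hb : IsStrictlyPositive b) : ‖geomP α a b‖ ≤ ‖sandwichQ α z a b‖ := by
  refine le_of_le_on_isStrictlyPositive (continuousOn_geomP hα b).norm
    (continuousOn_sandwichQ hα hz b).norm (fun a ha => ?_) ha
  refine norm_le_norm_of_homogeneous (f := fun a => sandwichQ α z a b)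
    (g := fun a => geomP α a b) hα
    (fun a ha t ht => sandwichQ_smul hα.le hz ht.le ha.nonneg b)
    (fun a ha t ht => geomP_smul hα.le ht.le ha.nonneg b)
    (fun a => sandwichQ_nonneg α z a b) (fun a => geomP_nonneg α a b) (fun a ha => ?_) ha
  rw [sandwichQ_le_one_iff hz hb, geomP_le_one_iff hb]
  rcases h with h | ⟨h1, h2⟩
  · exact geometric_rpow_le_of_lt_one ha hb hα h hz
  · exact geometric_rpow_le_of_one_lt ha hb h1 hz (h2.trans (min_le_left _ _))
      (h2.trans (min_le_right _ _))

theorem norm_sandwichQ_le_norm_geomP {α z : ℝ} (hα : 1 < α) (h : max (α / 2) (α - 1) ≤ z)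
    {a b : 𝒜} (ha : 0 ≤ a) (hb : IsStrictlyPositive b) :
    ‖sandwichQ α z a b‖ ≤ ‖geomP α a b‖ := by
  have hα0 : 0 < α := by linarith
  have h1 := (le_max_left _ _).trans h
  have h2 := (le_max_right _ _).trans h
  have hz : 0 < z := by linarith
  refine le_of_le_on_isStrictlyPositive (continuousOn_sandwichQ hα0 hz b).norm
    (continuousOn_geomP hα0 b).norm (fun a ha => ?_) ha
  refine norm_le_norm_of_homogeneous (f := fun a => geomP α a b)
    (g := fun a => sandwichQ α z a b) hα0
    (fun a ha t ht => geomP_smul hα0.le ht.le ha.nonneg b)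
    (fun a ha t ht => sandwichQ_smul hα0.le hz ht.le ha.nonneg b)
    (fun a => geomP_nonneg α a b) (fun a => sandwichQ_nonneg α z a b) (fun a ha => ?_) ha
  rw [sandwichQ_le_one_iff hz hb, geomP_le_one_iff hb]
  exact rpow_le_of_geometric_rpow_le ha hb hα h1 h2

end CStarNorm

/-! ### Spectral calculus of matrices and compound matrices. -/

section Compound

/-- The star algebra homomorphism `d ↦ u * diagonal d * star u` for a unitary `u`. -/
noncomputable def unitaryDiagonal {ι : Type*} [Fintype ι] [DecidableEq ι]
    (u : unitary (Matrix ι ι ℂ)) : (ι → ℝ) →⋆ₐ[ℝ] Matrix ι ι ℂ where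
  toFun d := Unitary.conjStarAlgAut ℂ _ u (Matrix.diagonal (RCLike.ofReal ∘ d))
  map_zero' := by simp [Function.comp_def, Pi.zero_def]
  map_one' := by simp [Function.comp_def, Pi.one_def]
  map_mul' f g := by
    simp only [← map_mul, Matrix.diagonal_mul_diagonal, Function.comp_apply]
    congr! with i
  map_add' f g := by
    simp only [← map_add, Matrix.diagonal_add, Function.comp_apply]
    congr! with i
  commutes' r := by
    simp only [Function.comp_def, Algebra.algebraMap_eq_smul_one, Pi.smul_apply, Pi.one_apply]
    rw [← mul_one (r • (1 : Matrix ι ι ℂ)), ← Unitary.mul_star_self_of_mem u.2]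
    simp [Unitary.conjStarAlgAut_apply, ← Matrix.smul_one_eq_diagonal]
  map_star' f := by
    simp only [← map_star, Matrix.star_eq_conjTranspose, Matrix.diagonal_conjTranspose]
    congr! 2
    ext i
    simp

section
variable {ι : Type*} [Fintype ι] [DecidableEq ι]

lemma unitaryDiagonal_apply (u : unitary (Matrix ι ι ℂ)) (d : ι → ℝ) :
    unitaryDiagonal u d = (u : Matrix ι ι ℂ) * Matrix.diagonal (fun i => (d i : ℂ)) *
      star (u : Matrix ι ι ℂ) := rfl

/-- The spectrum is finite, so f may be replaced by its Lagrange interpolant at the entries of d,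
and polynomials commute with algebra homomorphisms. No continuity of f is needed. -/
lemma cfc_unitaryDiagonal (u : unitary (Matrix ι ι ℂ)) (d : ι → ℝ) (f : ℝ → ℝ) :
    cfc f (unitaryDiagonal u d) = unitaryDiagonal u (f ∘ d) := by
  classical
  have hsa : IsSelfAdjoint (unitaryDiagonal u d) := by
    rw [IsSelfAdjoint, ← map_star]; rfl
  set q := Lagrange.interpolate (Finset.univ.image d) id f with hq
  have hqd : ∀ i, q.eval (d i) = f (d i) := fun i =>
    Lagrange.eval_interpolate_at_node (v := id) f Function.injective_id.injOn
      (Finset.mem_image_of_mem d (Finset.mem_univ i))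
  have hspec : spectrum ℝ (unitaryDiagonal u d) ⊆ Set.range d := by
    refine (AlgHom.spectrum_apply_subset (unitaryDiagonal u : (ι → ℝ) →ₐ[ℝ] Matrix ι ι ℂ) d).trans ?_
    rw [Pi.spectrum_eq, Set.iUnion_subset_iff]
    intro i x hx
    have : x = d i := by
      rwa [← Set.mem_singleton_iff, ← spectrum.scalar_eq (A := ℝ) (d i)]
    exact this ▸ Set.mem_range_self i
  have h1 : cfc f (unitaryDiagonal u d) = cfc q.eval (unitaryDiagonal u d) := by
    refine cfc_congr fun x hx => ?_
    obtain ⟨i, rfl⟩ := hspec hx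
    exact (hqd i).symm
  rw [h1, cfc_polynomial q _ hsa]
  rw [show Polynomial.aeval (unitaryDiagonal u d) q = unitaryDiagonal u (Polynomial.aeval d q) from
    Polynomial.aeval_algHom_apply (unitaryDiagonal u : (ι → ℝ) →ₐ[ℝ] Matrix ι ι ℂ) d q]
  congr 1
  ext i
  rw [Polynomial.aeval_pi_apply]
  simp [hqd]

lemma unitaryDiagonal_nonneg (u : unitary (Matrix ι ι ℂ)) {d : ι → ℝ} (hd : ∀ i, 0 ≤ d i) :
    0 ≤ unitaryDiagonal u d := by
  rw [unitaryDiagonal_apply]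
  refine star_right_conjugate_nonneg ?_ _
  rw [Matrix.nonneg_iff_posSemidef, Matrix.posSemidef_diagonal_iff]
  exact fun i => by exact_mod_cast hd i

lemma unitaryDiagonal_rpow (u : unitary (Matrix ι ι ℂ)) {d : ι → ℝ} (hd : ∀ i, 0 ≤ d i) (p : ℝ) :
    unitaryDiagonal u d ^ p = unitaryDiagonal u (fun i => d i ^ p) := by
  rw [CFC.rpow_eq_cfc_real (unitaryDiagonal_nonneg u hd), cfc_unitaryDiagonal]
  rfl

lemma Matrix.IsHermitian.eq_unitaryDiagonal {A : Matrix ι ι ℂ} (hA : A.IsHermitian) :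
    A = unitaryDiagonal hA.eigenvectorUnitary hA.eigenvalues := hA.spectral_theorem

lemma det_unitaryDiagonal (u : unitary (Matrix ι ι ℂ)) (d : ι → ℝ) :
    (unitaryDiagonal u d).det = ((∏ i, d i : ℝ) : ℂ) := by
  rw [unitaryDiagonal_apply, Matrix.det_mul, Matrix.det_mul, mul_right_comm, ← Matrix.det_mul,
    Unitary.mul_star_self_of_mem u.2]
  simp

open scoped Matrix.Norms.L2Operator in
lemma norm_unitaryDiagonal (u : unitary (Matrix ι ι ℂ)) (d : ι → ℝ) :
    ‖unitaryDiagonal u d‖ = ‖d‖ := by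
  rw [unitaryDiagonal_apply, ← Unitary.coe_star, CStarRing.norm_mul_coe_unitary,
    CStarRing.norm_coe_unitary_mul, Matrix.l2_opNorm_diagonal]
  simp [Pi.norm_def]

end

open Set (powersetCard)

variable {n : ℕ}

/-- The `k`-th compound matrix, whose entries are the `k × k` minors. -/
noncomputable def compound (k : ℕ) (A : Matrix (Fin n) (Fin n) ℂ) :
    Matrix (powersetCard (Fin n) k) (powersetCard (Fin n) k) ℂ :=
  LinearMap.toMatrix ((Pi.basisFun ℂ (Fin n)).exteriorPower k)
    ((Pi.basisFun ℂ (Fin n)).exteriorPower k) (exteriorPower.map k (Matrix.toLin' A))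

lemma compound_mul (k : ℕ) (A B : Matrix (Fin n) (Fin n) ℂ) :
    compound k (A * B) = compound k A * compound k B := by
  rw [compound, Matrix.toLin'_mul, exteriorPower.map_comp, LinearMap.toMatrix_comp _
    ((Pi.basisFun ℂ (Fin n)).exteriorPower k)]
  rfl

lemma compound_one (k : ℕ) : compound k (1 : Matrix (Fin n) (Fin n) ℂ) = 1 := by
  rw [compound, Matrix.toLin'_one, exteriorPower.map_id, LinearMap.toMatrix_id]

lemma compound_apply (k : ℕ) (A : Matrix (Fin n) (Fin n) ℂ) (s t : powersetCard (Fin n) k) :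
    compound k A s t = (A.submatrix (powersetCard.ofFinEmbEquiv.symm s)
      (powersetCard.ofFinEmbEquiv.symm t)).det := by
  rw [compound, LinearMap.toMatrix_apply, exteriorPower.basis_apply,
    exteriorPower.map_apply_ιMulti_family, exteriorPower.basis_repr_apply,
    exteriorPower.ιMulti_family, exteriorPower.ιMultiDual_apply_ιMulti, ← Matrix.det_transpose]
  congr 1
  ext i j
  simp

lemma compound_conjTranspose (k : ℕ) (A : Matrix (Fin n) (Fin n) ℂ) :
    compound k A.conjTranspose = (compound k A).conjTranspose := by
  ext s t
  rw [Matrix.conjTranspose_apply, compound_apply, compound_apply, ← Matrix.det_conjTranspose,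
    Matrix.conjTranspose_submatrix]

lemma compound_diagonal (k : ℕ) (d : Fin n → ℂ) :
    compound k (Matrix.diagonal d) =
      Matrix.diagonal fun s : powersetCard (Fin n) k => ∏ i ∈ s.val, d i := by
  ext s t
  rw [compound, LinearMap.toMatrix_apply, exteriorPower.basis_apply,
    exteriorPower.map_apply_ιMulti_family, exteriorPower.ιMulti_family]
  have : ((Matrix.toLin' (Matrix.diagonal d)) ∘ (Pi.basisFun ℂ (Fin n))) ∘
      (powersetCard.ofFinEmbEquiv.symm t) = fun i => d (powersetCard.ofFinEmbEquiv.symm t i) •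
        (Pi.basisFun ℂ (Fin n) ∘ (powersetCard.ofFinEmbEquiv.symm t)) i := by
    ext i j
    by_cases h : j = powersetCard.ofFinEmbEquiv.symm t i <;>
      simp [Matrix.mulVec_diagonal, h]
  have hp : ∏ i, d (powersetCard.ofFinEmbEquiv.symm t i) = ∏ i ∈ t.val, d i := by
    conv_rhs => rw [← Finset.image_orderEmbOfFin_univ t.val t.prop]
    rw [Finset.prod_image (t.val.orderEmbOfFin t.prop).injective.injOn]
    rfl
  rw [this, AlternatingMap.map_smul_univ, hp]
  change _ = _
  rw [map_smul, ← exteriorPower.ιMulti_family, exteriorPower.basis_repr, Matrix.diagonal_apply]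
  rcases eq_or_ne s t with rfl | h
  · simp
  · simp [h]

/-- The compound of a unitary matrix. -/
noncomputable def compoundUnitary (k : ℕ) (u : unitary (Matrix (Fin n) (Fin n) ℂ)) :
    unitary (Matrix (powersetCard (Fin n) k) (powersetCard (Fin n) k) ℂ) :=
  ⟨compound k u, by
    rw [Unitary.mem_iff, Matrix.star_eq_conjTranspose, ← compound_conjTranspose, ← compound_mul,
      ← compound_mul, ← Matrix.star_eq_conjTranspose, Unitary.mul_star_self_of_mem u.2,
      Unitary.star_mul_self_of_mem u.2, compound_one]
    simp⟩

lemma compound_unitaryDiagonal (k : ℕ) (u : unitary (Matrix (Fin n) (Fin n) ℂ)) (d : Fin n → ℝ) :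
    compound k (unitaryDiagonal u d) = unitaryDiagonal (compoundUnitary k u)
      fun s : powersetCard (Fin n) k => ∏ i ∈ s.val, d i := by
  rw [unitaryDiagonal_apply, unitaryDiagonal_apply, compound_mul, compound_mul, compound_diagonal,
    Matrix.star_eq_conjTranspose, compound_conjTranspose]
  simp [compoundUnitary, Matrix.star_eq_conjTranspose]

lemma compound_nonneg (k : ℕ) {A : Matrix (Fin n) (Fin n) ℂ} (hA : 0 ≤ A) :
    0 ≤ compound k A := by
  have hA' := Matrix.nonneg_iff_posSemidef.mp hA
  rw [hA'.isHermitian.eq_unitaryDiagonal, compound_unitaryDiagonal]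
  exact unitaryDiagonal_nonneg _ fun s => Finset.prod_nonneg fun i _ => hA'.eigenvalues_nonneg i

/-- In an eigenbasis the compound is diagonal with entries the products over `k`-subsets of
eigenvalues, and powers of nonnegative reals are multiplicative. -/
lemma compound_rpow (k : ℕ) {A : Matrix (Fin n) (Fin n) ℂ} (hA : 0 ≤ A) (p : ℝ) :
    compound k (A ^ p) = compound k A ^ p := by
  have hA' := Matrix.nonneg_iff_posSemidef.mp hA
  have h0 := hA'.eigenvalues_nonneg
  rw [hA'.isHermitian.eq_unitaryDiagonal, unitaryDiagonal_rpow _ h0, compound_unitaryDiagonal,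
    compound_unitaryDiagonal, unitaryDiagonal_rpow _ fun s => Finset.prod_nonneg fun i _ => h0 i]
  congr 1
  ext s
  exact Real.finsetProd_rpow _ _ (fun i _ => h0 i) p

lemma compound_isStrictlyPositive (k : ℕ) {A : Matrix (Fin n) (Fin n) ℂ}
    (hA : IsStrictlyPositive A) : IsStrictlyPositive (compound k A) := by
  refine IsUnit.isStrictlyPositive ?_ (compound_nonneg k hA.nonneg)
  obtain ⟨v, hv⟩ := hA.isUnit
  refine ⟨⟨compound k A, compound k ↑v⁻¹, ?_, ?_⟩, rfl⟩ <;>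
    simp [← hv, ← compound_mul, compound_one]

lemma prod_le_prod_of_antitone {m k : ℕ} {f : Fin m → ℝ} (hf : Antitone f) (hf0 : ∀ i, 0 ≤ f i)
    {s : Finset (Fin m)} (hs : s.card = k) : ∏ i ∈ s, f i ≤ ∏ i with i.val < k, f i := by
  have hk : k ≤ m := by simpa [hs] using Finset.card_le_univ s
  have h1 : (Finset.univ.filter fun i : Fin m => i.val < k) = Finset.univ.image (Fin.castLE hk) := by
    ext i
    simp only [Finset.mem_filter, Finset.mem_univ, true_and, Finset.mem_image]
    exact ⟨fun h => ⟨⟨i, h⟩, rfl⟩, by rintro ⟨j, rfl⟩; exact j.2⟩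
  rw [h1, Finset.prod_image (by intro a _ b _ h; simpa using h)]
  conv_lhs => rw [← Finset.image_orderEmbOfFin_univ s hs]
  rw [Finset.prod_image (s.orderEmbOfFin hs).injective.injOn]
  refine Finset.prod_le_prod (fun i _ => hf0 _) fun i _ => hf ?_
  -- The element of index j in the increasing enumeration of `s` is at least j, so antitonicity
  -- compares the products factor by factor.
  have key : ∀ (j : ℕ) (hj : j < k), j ≤ (s.orderEmbOfFin hs ⟨j, hj⟩).val := by
    intro j
    induction j with
    | zero => intro _; exact Nat.zero_le _
    | succ j ih =>
      intro hj
      have : s.orderEmbOfFin hs ⟨j, by omega⟩ < s.orderEmbOfFin hs ⟨j + 1, hj⟩ := by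
        simp
      have h2 := ih (by omega)
      have h3 : (s.orderEmbOfFin hs ⟨j, by omega⟩).val < (s.orderEmbOfFin hs ⟨j + 1, hj⟩).val := this
      omega
  exact key i.val i.2

open scoped Matrix.Norms.L2Operator in
/-- The norm of the `k`-th compound is the product of the `k` largest eigenvalues. -/
lemma norm_compound {k : ℕ} (hk : k ≤ n) {A : Matrix (Fin n) (Fin n) ℂ} (hA : A.PosSemidef) :
    ‖compound k A‖ = ∏ i with i.val < k, hA.isHermitian.eigenvalues₀ i := by
  set f := hA.isHermitian.eigenvalues₀ with hf
  -- The same enumeration that defines `eigenvalues` from `eigenvalues₀`, so the next identity is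
  -- definitional.
  let e : Fin (Fintype.card (Fin n)) ≃ Fin n :=
    Fintype.equivOfCardEq (Fintype.card_fin (Fintype.card (Fin n)))
  have hfe : ∀ i, hA.isHermitian.eigenvalues i = f (e.symm i) := fun i => rfl
  have hf0 : ∀ i, 0 ≤ f i := fun i => by
    simpa [hfe] using hA.eigenvalues_nonneg (e i)
  conv_lhs => rw [hA.isHermitian.eq_unitaryDiagonal, compound_unitaryDiagonal, norm_unitaryDiagonal]
  have hs : ∀ s : Finset (Fin n), ∏ i ∈ s, hA.isHermitian.eigenvalues i =
      ∏ i ∈ s.map e.symm.toEmbedding, f i := fun s => by simp [hfe]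
  refine le_antisymm ((pi_norm_le_iff_of_nonneg (Finset.prod_nonneg fun i _ => hf0 i)).mpr ?_) ?_
  · intro s
    rw [Real.norm_of_nonneg (Finset.prod_nonneg fun i _ => hA.eigenvalues_nonneg i), hs]
    exact prod_le_prod_of_antitone hA.isHermitian.eigenvalues₀_antitone hf0
      (by rw [Finset.card_map]; exact s.prop)
  · have hc : ((Finset.univ.filter fun i : Fin (Fintype.card (Fin n)) => i.val < k).map
        e.toEmbedding).card = k := by
      rw [Finset.card_map, Fin.card_filter_val_lt]
      simpa using hk
    let s : powersetCard (Fin n) k := ⟨_, hc⟩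
    refine le_trans (le_of_eq ?_) (norm_le_pi_norm _ s)
    rw [Real.norm_of_nonneg (Finset.prod_nonneg fun i _ => hA.eigenvalues_nonneg i), hs]
    simp [s, Finset.map_map]

end Compound

/-! ### Log-majorization and its consequence for traces. -/

section LogMajorization

variable {n : ℕ}

open scoped Matrix.Norms.L2Operator in
lemma compound_geomP (k : ℕ) (α : ℝ) {A B : Matrix (Fin n) (Fin n) ℂ} (hA : 0 ≤ A) (hB : 0 ≤ B) :
    compound k (renyiP α A B) = geomP α (compound k A) (compound k B) := by
  have h : 0 ≤ B ^ (-(1 / 2) : ℝ) * A * B ^ (-(1 / 2) : ℝ) :=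
    IsSelfAdjoint.conjugate_nonneg hA (IsSelfAdjoint.of_nonneg CFC.rpow_nonneg)
  rw [renyiP, compound_mul, compound_mul, compound_rpow k h, compound_mul, compound_mul,
    compound_rpow k hB, compound_rpow k hB]
  rfl

open scoped Matrix.Norms.L2Operator in
lemma compound_sandwichQ (k : ℕ) (α z : ℝ) {A B : Matrix (Fin n) (Fin n) ℂ} (hA : 0 ≤ A)
    (hB : 0 ≤ B) : compound k (renyiQ α z A B) = sandwichQ α z (compound k A) (compound k B) := by
  have h : 0 ≤ B ^ ((1 - α) / (2 * z)) * A ^ (α / z) * B ^ ((1 - α) / (2 * z)) :=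
    IsSelfAdjoint.conjugate_nonneg CFC.rpow_nonneg (IsSelfAdjoint.of_nonneg CFC.rpow_nonneg)
  rw [renyiQ, compound_rpow k h, compound_mul, compound_mul, compound_rpow k hB,
    compound_rpow k hA]
  rfl

lemma renyiP_nonneg (α : ℝ) (A B : Matrix (Fin n) (Fin n) ℂ) : 0 ≤ renyiP α A B :=
  IsSelfAdjoint.conjugate_nonneg CFC.rpow_nonneg (IsSelfAdjoint.of_nonneg CFC.rpow_nonneg)

lemma renyiQ_nonneg (α z : ℝ) (A B : Matrix (Fin n) (Fin n) ℂ) : 0 ≤ renyiQ α z A B :=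
  CFC.rpow_nonneg

lemma det_eq_ofReal {A : Matrix (Fin n) (Fin n) ℂ} (hA : 0 ≤ A) :
    A.det = (A.det.re : ℂ) := by
  rw [(Matrix.nonneg_iff_posSemidef.mp hA).isHermitian.eq_unitaryDiagonal, det_unitaryDiagonal,
    Complex.ofReal_re]

lemma det_re_nonneg {A : Matrix (Fin n) (Fin n) ℂ} (hA : 0 ≤ A) : 0 ≤ A.det.re :=
  (Complex.le_def.mp (Matrix.nonneg_iff_posSemidef.mp hA).det_nonneg).1

lemma det_rpow {A : Matrix (Fin n) (Fin n) ℂ} (hA : 0 ≤ A) (p : ℝ) :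
    (A ^ p).det = ((A.det.re ^ p : ℝ) : ℂ) := by
  have hA' := Matrix.nonneg_iff_posSemidef.mp hA
  have h0 := hA'.eigenvalues_nonneg
  rw [hA'.isHermitian.eq_unitaryDiagonal, unitaryDiagonal_rpow _ h0, det_unitaryDiagonal,
    det_unitaryDiagonal, Complex.ofReal_re, Real.finsetProd_rpow _ _ fun i _ => h0 i]

lemma det_renyiP {α : ℝ} {A B : Matrix (Fin n) (Fin n) ℂ} (hA : 0 ≤ A)
    (hB : IsStrictlyPositive B) :
    (renyiP α A B).det = ((A.det.re ^ α * B.det.re ^ (1 - α) : ℝ) : ℂ) := by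
  have h : 0 ≤ B ^ (-(1 / 2) : ℝ) * A * B ^ (-(1 / 2) : ℝ) :=
    IsSelfAdjoint.conjugate_nonneg hA (IsSelfAdjoint.of_nonneg CFC.rpow_nonneg)
  have hb : 0 < B.det.re := (Complex.lt_def.mp (Matrix.isStrictlyPositive_iff_posDef.mp hB).det_pos).1
  rw [renyiP, Matrix.det_mul, Matrix.det_mul, det_rpow h, Matrix.det_mul, Matrix.det_mul,
    det_rpow hB.nonneg, det_rpow hB.nonneg, det_eq_ofReal hA]
  have ha := det_re_nonneg hA
  norm_cast
  generalize A.det.re = a at *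
  generalize B.det.re = b at *
  rw [Real.mul_rpow (by positivity) (by positivity), Real.mul_rpow (by positivity) ha,
    ← Real.rpow_mul hb.le]
  rw [show b ^ (1 / 2 : ℝ) * (b ^ (-(1 / 2) * α) * a ^ α * b ^ (-(1 / 2) * α)) * b ^ (1 / 2 : ℝ)
    = a ^ α * (b ^ (1 / 2 : ℝ) * b ^ (1 / 2 : ℝ) * b ^ (-(1 / 2) * α) * b ^ (-(1 / 2) * α)) by ring,
    ← Real.rpow_add hb, ← Real.rpow_add hb, ← Real.rpow_add hb]
  congr 2; ring

lemma det_renyiQ {α z : ℝ} (hz : 0 < z) {A B : Matrix (Fin n) (Fin n) ℂ} (hA : 0 ≤ A)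
    (hB : IsStrictlyPositive B) :
    (renyiQ α z A B).det = ((A.det.re ^ α * B.det.re ^ (1 - α) : ℝ) : ℂ) := by
  have h : 0 ≤ B ^ ((1 - α) / (2 * z)) * A ^ (α / z) * B ^ ((1 - α) / (2 * z)) :=
    IsSelfAdjoint.conjugate_nonneg CFC.rpow_nonneg (IsSelfAdjoint.of_nonneg CFC.rpow_nonneg)
  have hb : 0 < B.det.re := (Complex.lt_def.mp (Matrix.isStrictlyPositive_iff_posDef.mp hB).det_pos).1
  rw [renyiQ, det_rpow h, Matrix.det_mul, Matrix.det_mul, det_rpow hB.nonneg, det_rpow hA]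
  have ha := det_re_nonneg hA
  norm_cast
  generalize A.det.re = a at *
  generalize B.det.re = b at *
  rw [Real.mul_rpow (by positivity) (by positivity), Real.mul_rpow (by positivity) (by positivity),
    ← Real.rpow_mul hb.le, ← Real.rpow_mul ha, div_mul_cancel₀ _ hz.ne', mul_right_comm,
    ← Real.rpow_add hb, mul_comm]
  congr 2; field_simp; ring

lemma prod_eigenvalues₀ {A : Matrix (Fin n) (Fin n) ℂ} (hA : A.IsHermitian) :
    ((∏ i, hA.eigenvalues₀ i : ℝ) : ℂ) = A.det := by
  rw [hA.det_eq_prod_eigenvalues]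
  push_cast
  exact Fintype.prod_equiv
    (Fintype.equivOfCardEq (Fintype.card_fin (Fintype.card (Fin n)))) _ _ fun i => by
      simp [Matrix.IsHermitian.eigenvalues]

open scoped Matrix.Norms.L2Operator in
lemma LogMajorized.of_norm_compound_le {X Y : Matrix (Fin n) (Fin n) ℂ} (hX : 0 ≤ X) (hY : 0 ≤ Y)
    (h : ∀ k, ‖compound k X‖ ≤ ‖compound k Y‖) (hdet : X.det = Y.det) : LogMajorized X Y := by
  refine ⟨Matrix.nonneg_iff_posSemidef.mp hX, Matrix.nonneg_iff_posSemidef.mp hY,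
    fun k _ hk => ?_, ?_⟩
  · rw [← norm_compound hk (Matrix.nonneg_iff_posSemidef.mp hX),
      ← norm_compound hk (Matrix.nonneg_iff_posSemidef.mp hY)]
    exact h k
  · rw [← prod_eigenvalues₀ (Matrix.nonneg_iff_posSemidef.mp hX).isHermitian,
      ← prod_eigenvalues₀ (Matrix.nonneg_iff_posSemidef.mp hY).isHermitian] at hdet
    exact_mod_cast hdet

open scoped Matrix.Norms.L2Operator in
theorem logMajorized_renyiP_renyiQ {α z : ℝ} (hα : 0 < α) (hz : 0 < z)
    (h : α < 1 ∨ 1 < α ∧ z ≤ min (α / 2) (α - 1)) {A B : Matrix (Fin n) (Fin n) ℂ}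
    (hA : A.PosSemidef) (hB : B.PosDef) : LogMajorized (renyiP α A B) (renyiQ α z A B) := by
  refine .of_norm_compound_le (renyiP_nonneg _ _ _) (renyiQ_nonneg _ _ _ _) (fun k => ?_) ?_
  · rw [compound_geomP k α hA.nonneg hB.posSemidef.nonneg,
      compound_sandwichQ k α z hA.nonneg hB.posSemidef.nonneg]
    exact norm_geomP_le_norm_sandwichQ hα hz h (compound_nonneg k hA.nonneg)
      (compound_isStrictlyPositive k hB.isStrictlyPositive)
  · rw [det_renyiP hA.nonneg hB.isStrictlyPositive, det_renyiQ hz hA.nonneg hB.isStrictlyPositive]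

open scoped Matrix.Norms.L2Operator in
theorem logMajorized_renyiQ_renyiP {α z : ℝ} (hα : 1 < α) (hz : 0 < z)
    (h : max (α / 2) (α - 1) ≤ z) {A B : Matrix (Fin n) (Fin n) ℂ}
    (hA : A.PosSemidef) (hB : B.PosDef) : LogMajorized (renyiQ α z A B) (renyiP α A B) := by
  refine .of_norm_compound_le (renyiQ_nonneg _ _ _ _) (renyiP_nonneg _ _ _) (fun k => ?_) ?_
  · rw [compound_geomP k α hA.nonneg hB.posSemidef.nonneg,
      compound_sandwichQ k α z hA.nonneg hB.posSemidef.nonneg]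
    exact norm_sandwichQ_le_norm_geomP hα h (compound_nonneg k hA.nonneg)
      (compound_isStrictlyPositive k hB.isStrictlyPositive)
  · rw [det_renyiP hA.nonneg hB.isStrictlyPositive, det_renyiQ hz hA.nonneg hB.isStrictlyPositive]

/-- Weighted sums with antitone nonnegative weights of a sequence with nonnegative partial sums
are nonnegative. -/
lemma sum_mul_nonneg_of_antitone {m : ℕ} (w l : ℕ → ℝ)
    (hw : ∀ i, i + 1 < m → w (i + 1) ≤ w i) (hw0 : ∀ i < m, 0 ≤ w i)
    (hl : ∀ k ≤ m, 0 ≤ ∑ i ∈ Finset.range k, l i) :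
    0 ≤ ∑ i ∈ Finset.range m, w i * l i := by
  have := Finset.sum_range_by_parts w l m
  simp only [smul_eq_mul] at this
  rw [this, sub_nonneg]
  rcases Nat.eq_zero_or_pos m with rfl | hm
  · simp
  refine (Finset.sum_nonpos fun i hi => ?_).trans (mul_nonneg (hw0 _ (by omega)) (hl m le_rfl))
  have hi' := Finset.mem_range.mp hi
  exact mul_nonpos_of_nonpos_of_nonneg (sub_nonpos.mpr (hw i (by omega))) (hl _ (by omega))

/-- Weak log-majorization of nonnegative decreasing sequences implies the inequality of sums. -/
lemma sum_le_sum_of_prod_le_prod {m : ℕ} (x y : ℕ → ℝ)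
    (hx : ∀ i, i + 1 < m → x (i + 1) ≤ x i) (hx0 : ∀ i < m, 0 ≤ x i) (hy0 : ∀ i < m, 0 ≤ y i)
    (h : ∀ k ≤ m, ∏ i ∈ Finset.range k, x i ≤ ∏ i ∈ Finset.range k, y i) :
    ∑ i ∈ Finset.range m, x i ≤ ∑ i ∈ Finset.range m, y i := by
  induction m with
  | zero => simp
  | succ m ih =>
    by_cases hxm : 0 < x m
    · have hpos : ∀ i ≤ m, 0 < x i := fun i hi => by
        induction hi using Nat.decreasingInduction with
        | self => exact hxm
        | of_succ k hk ih => exact ih.trans_le (hx k (by omega))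
      have hypos : ∀ i ≤ m, 0 < y i := fun i hi => by
        have h1 : 0 < ∏ i ∈ Finset.range (m + 1), y i :=
          (Finset.prod_pos fun i hi => hpos i (by simpa [Nat.lt_succ_iff] using hi)).trans_le
            (h _ le_rfl)
        refine (hy0 i (by omega)).lt_of_ne fun h0 => h1.ne' ?_
        exact Finset.prod_eq_zero (Finset.mem_range.mpr (by omega)) h0.symm
      -- The weights are the x i themselves: the sum of x log(y/x) is nonnegative, and x log(y/x) ≤
      -- y - x because log u ≤ u - 1.
      have key := sum_mul_nonneg_of_antitone (m := m + 1) x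
        (fun i => Real.log (y i) - Real.log (x i)) hx hx0 fun k hk => by
          rw [Finset.sum_sub_distrib, sub_nonneg,
            ← Real.log_prod fun i hi => (hpos i (by have := Finset.mem_range.mp hi; omega)).ne',
            ← Real.log_prod fun i hi => (hypos i (by have := Finset.mem_range.mp hi; omega)).ne']
          exact Real.log_le_log
            (Finset.prod_pos fun i hi => hpos i (by have := Finset.mem_range.mp hi; omega)) (h k hk)
      rw [← sub_nonneg, ← Finset.sum_sub_distrib]
      refine key.trans (Finset.sum_le_sum fun i hi => ?_)
      have hi' : i ≤ m := by have := Finset.mem_range.mp hi; omega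
      have hxi := hpos i hi'
      rw [← Real.log_div (hypos i hi').ne' hxi.ne']
      have h2 := Real.log_le_sub_one_of_pos (div_pos (hypos i hi') hxi)
      calc x i * Real.log (y i / x i) ≤ x i * (y i / x i - 1) := by gcongr
        _ = y i - x i := by field_simp
    · have h0 : x m = 0 := le_antisymm (not_lt.mp hxm) (hx0 m (by omega))
      rw [Finset.sum_range_succ, Finset.sum_range_succ, h0, add_zero]
      have := ih (fun i hi => hx i (by omega)) (fun i hi => hx0 i (by omega))
        (fun i hi => hy0 i (by omega)) (fun k hk => h k (by omega))
      linarith [hy0 m (by omega)]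

lemma trace_re_eq_sum_eigenvalues₀ {A : Matrix (Fin n) (Fin n) ℂ} (hA : A.IsHermitian) :
    A.trace.re = ∑ i, hA.eigenvalues₀ i := by
  rw [hA.trace_eq_sum_eigenvalues, Complex.re_sum]
  refine (Fintype.sum_equiv
    (Fintype.equivOfCardEq (Fintype.card_fin (Fintype.card (Fin n)))) _ _ fun i => ?_).symm
  simp [Matrix.IsHermitian.eigenvalues]

lemma LogMajorized.trace_re_le {X Y : Matrix (Fin n) (Fin n) ℂ} (h : LogMajorized X Y) :
    X.trace.re ≤ Y.trace.re := by
  obtain ⟨hX, hY, h1, -⟩ := h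
  rw [trace_re_eq_sum_eigenvalues₀ hX.isHermitian, trace_re_eq_sum_eigenvalues₀ hY.isHermitian]
  have hn : Fintype.card (Fin n) = n := Fintype.card_fin n
  have nonneg : ∀ {A : Matrix (Fin n) (Fin n) ℂ} (hA : A.PosSemidef) i,
      0 ≤ hA.isHermitian.eigenvalues₀ i := fun hA i => by
    simpa [Matrix.IsHermitian.eigenvalues] using hA.eigenvalues_nonneg
      (Fintype.equivOfCardEq (Fintype.card_fin (Fintype.card (Fin n))) i)
  have hXa := hX.isHermitian.eigenvalues₀_antitone
  have hX0 := nonneg hX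
  have hY0 := nonneg hY
  clear nonneg
  generalize hX.isHermitian.eigenvalues₀ = x at *
  generalize hY.isHermitian.eigenvalues₀ = y at *
  generalize Fintype.card (Fin n) = m at *
  subst hn
  let ext : (Fin m → ℝ) → ℕ → ℝ := fun f i => if hi : i < m then f ⟨i, hi⟩ else 0
  have hext : ∀ f (i : Fin m), ext f i = f i := fun f i => by simp [ext]
  have hext' : ∀ f i (hi : i < m), ext f i = f ⟨i, hi⟩ := fun f i hi => by simp [ext, hi]
  have hprod : ∀ f k, k ≤ m → ∏ i ∈ Finset.range k, ext f i = ∏ i : Fin m with i.val < k, f i := by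
    intro f k hk
    simp_rw [← hext f]
    refine (Finset.prod_bij (fun (i : Fin m) _ => i.val) (fun i hi => by simpa using hi)
      (fun i _ j _ hij => Fin.ext hij) (fun i hi => ?_) fun i _ => rfl).symm
    have hi' := Finset.mem_range.mp hi
    exact ⟨⟨i, by omega⟩, by simpa using hi', rfl⟩
  have key := sum_le_sum_of_prod_le_prod (m := m) (ext x) (ext y)
    (fun i hi => by
      rw [hext' x _ hi, hext' x i (by omega)]
      exact hXa (Fin.mk_le_mk.mpr (by omega)))
    (fun i hi => by rw [hext' x i hi]; exact hX0 _)
    (fun i hi => by rw [hext' y i hi]; exact hY0 _)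
    (fun k hk => by
      rcases Nat.eq_zero_or_pos k with rfl | hk0
      · simp
      · rw [hprod x k hk, hprod y k hk]; exact h1 k hk0 hk)
  rw [← Fin.sum_univ_eq_sum_range, ← Fin.sum_univ_eq_sum_range] at key
  simpa only [hext] using key

end LogMajorization

/-! ### Powers of compressed projections, and P in terms of b⁻¹. -/

section RankOne

variable {𝒜 : Type*} [CStarAlgebra 𝒜] [PartialOrder 𝒜] [StarOrderedRing 𝒜]

lemma rpow_eq_self_of_mul_self {e : 𝒜} (he : 0 ≤ e) (hee : IsIdempotentElem e) {p : ℝ}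
    (hp : 0 < p) : e ^ p = e := by
  rw [CFC.rpow_eq_cfc_real he]
  conv_rhs => rw [← cfc_id' ℝ e (IsSelfAdjoint.of_nonneg he)]
  refine cfc_congr fun x hx => ?_
  rcases hee.spectrum_subset ℝ hx with rfl | rfl
  · exact Real.zero_rpow hp.ne'
  · exact Real.one_rpow p

/-- Powers of a conjugated rank-one projection. -/
lemma conj_projection_rpow {e s : 𝒜} (he : 0 ≤ e) (hs : IsSelfAdjoint s)
    {c : ℝ} (hc : 0 < c) (h : e * (s * s) * e = c • e) {p : ℝ} (hp : 0 < p) :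
    (s * e * s) ^ p = c ^ (p - 1) • (s * e * s) := by
  have h0 : 0 ≤ s * e * s := IsSelfAdjoint.conjugate_nonneg he hs
  have hg0 : 0 ≤ c⁻¹ • (s * e * s) := smul_nonneg (by positivity) h0
  -- The normalized element is again a projection, hence fixed by every positive power; only the
  -- scalar c is raised to the power p.
  have hgg : c⁻¹ • (s * e * s) * c⁻¹ • (s * e * s) = c⁻¹ • (s * e * s) := by
    rw [smul_mul_smul_comm, show s * e * s * (s * e * s) = s * (e * (s * s) * e) * s by
      simp only [mul_assoc], h, mul_smul_comm, smul_mul_assoc, smul_smul]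
    congr 1; field_simp
  conv_lhs => rw [← one_smul ℝ (s * e * s), ← mul_inv_cancel₀ hc.ne', ← smul_smul,
    rpow_smul hg0 hc.le hp.le, rpow_eq_self_of_mul_self hg0 hgg hp, smul_smul]
  rw [Real.rpow_sub hc, Real.rpow_one, div_eq_mul_inv]

/-- The polar identity leaves only b⁻¹, inside a power α - 1. For α > 1 this form still makes sense
when b⁻¹ is replaced by a singular positive element. -/
lemma geomP_eq {α : ℝ} {a b : 𝒜} (ha : IsStrictlyPositive a) (hb : IsStrictlyPositive b) :
    geomP α a b = a ^ (1 / 2 : ℝ) * (a ^ (1 / 2 : ℝ) * b ^ (-1 : ℝ) * a ^ (1 / 2 : ℝ)) ^ (α - 1) *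
      a ^ (1 / 2 : ℝ) := by
  have e := rpow_conj_rpow ha hb (x := -(1 / 2)) (y := 1 / 2) (x' := -1) (y' := 1)
      (by norm_num) (by norm_num) α
  rw [CFC.rpow_one a ha.nonneg] at e
  rw [geomP, e]
  generalize a ^ (1 / 2 : ℝ) * (a ^ (1 / 2 : ℝ) * b ^ (-1 : ℝ) * a ^ (1 / 2 : ℝ)) ^ (α - 1) *
      a ^ (1 / 2 : ℝ) = y
  rw [show b ^ (1 / 2 : ℝ) * (b ^ (-(1 / 2) : ℝ) * y * b ^ (-(1 / 2) : ℝ)) * b ^ (1 / 2 : ℝ)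
    = (b ^ (1 / 2 : ℝ) * b ^ (-(1 / 2) : ℝ)) * y * (b ^ (-(1 / 2) : ℝ) * b ^ (1 / 2 : ℝ)) by
      simp only [mul_assoc], CFC.rpow_mul_rpow_neg _ hb, CFC.rpow_neg_mul_rpow _ hb, one_mul,
    mul_one]

end RankOne

/-! ### Traces as functions of A and of R = B⁻¹. -/

section Traces

open scoped Matrix.Norms.L2Operator

variable {ι : Type*} [Fintype ι] [DecidableEq ι]

/-- X⋆X and XX⋆ have powers of equal trace; here this comes from the polar identity and cyclicity.
As for P, the new form extends to singular B⁻¹ when α > 1. -/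
lemma trace_sandwichQ_eq {α z : ℝ} (hz : z ≠ 0) {A B : Matrix ι ι ℂ}
    (hA : IsStrictlyPositive A) (hB : IsStrictlyPositive B) :
    (sandwichQ α z A B).trace =
      ((A ^ (α / (2 * z)) * (B ^ (-1 : ℝ)) ^ ((α - 1) / z) * A ^ (α / (2 * z))) ^ z).trace := by
  have e := rpow_conj_rpow hA hB (x := (1 - α) / (2 * z)) (y := α / (2 * z)) (x' := (1 - α) / z)
    (y' := α / z) (by field_simp; ring) (by field_simp; ring) z
  rw [sandwichQ, e, rpow_rpow_of_isStrictlyPositive hB,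
    show -1 * ((α - 1) / z) = (1 - α) / z by field_simp; ring]
  have hS : IsStrictlyPositive (A ^ (α / (2 * z)) * B ^ ((1 - α) / z) * A ^ (α / (2 * z))) :=
    isStrictlyPositive_rpow_conj (hB.rpow _ _) hA _
  set S := A ^ (α / (2 * z)) * B ^ ((1 - α) / z) * A ^ (α / (2 * z)) with hSdef
  have h1 : S ^ z = S ^ (z - 1) * S := by
    nth_rw 3 [← CFC.rpow_one S hS.nonneg]
    rw [← CFC.rpow_add hS.isUnit, sub_add_cancel]
  have h2 : (1 - α) / z = (1 - α) / (2 * z) + (1 - α) / (2 * z) := by field_simp; ring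
  have h3 : ∀ X Y T : Matrix ι ι ℂ, (X * (Y * T * Y) * X).trace = (T * (Y * (X * X) * Y)).trace := by
    intro X Y T
    simp only [mul_assoc]
    rw [Matrix.trace_mul_comm X]
    simp only [mul_assoc]
    rw [Matrix.trace_mul_comm Y]
    simp only [mul_assoc]
  rw [h3, h1, ← CFC.rpow_add hB.isUnit, ← h2]

lemma continuousOn_trace_re {ι : Type*} [Fintype ι] [DecidableEq ι]
    {f : Matrix ι ι ℂ → Matrix ι ι ℂ} {s : Set (Matrix ι ι ℂ)}
    (hf : ContinuousOn f s) : ContinuousOn (fun A => (f A).trace.re) s := by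
  have h : Continuous fun A : Matrix ι ι ℂ => A.trace.re :=
    Complex.continuous_re.comp continuous_id.matrix_trace
  exact h.comp_continuousOn hf

lemma continuousOn_trace_re_geomP {α : ℝ} (hα : 0 < α) (B : Matrix ι ι ℂ) :
    ContinuousOn (fun A => (geomP α A B).trace.re) {A | 0 ≤ A} :=
  continuousOn_trace_re (continuousOn_geomP hα B)

lemma continuousOn_trace_re_sandwichQ {α z : ℝ} (hα : 0 < α) (hz : 0 < z) (B : Matrix ι ι ℂ) :
    ContinuousOn (fun A => (sandwichQ α z A B).trace.re) {A | 0 ≤ A} :=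
  continuousOn_trace_re (continuousOn_sandwichQ hα hz B)

/-- `Tr P_α(A, R⁻¹)` as a function of `R`. -/
noncomputable def traceP (α : ℝ) (A R : Matrix ι ι ℂ) : ℝ :=
  (A ^ (1 / 2 : ℝ) * (A ^ (1 / 2 : ℝ) * R * A ^ (1 / 2 : ℝ)) ^ (α - 1) *
      A ^ (1 / 2 : ℝ)).trace.re

/-- `Tr Q_{α,z}(A, R⁻¹)` as a function of `R`. -/
noncomputable def traceQ (α z : ℝ) (A R : Matrix ι ι ℂ) : ℝ :=
  ((A ^ (α / (2 * z)) * R ^ ((α - 1) / z) * A ^ (α / (2 * z))) ^ z).trace.re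

lemma traceP_eq {α : ℝ} {A R : Matrix ι ι ℂ} (hA : IsStrictlyPositive A)
    (hR : IsStrictlyPositive R) : traceP α A R = (geomP α A (R ^ (-1 : ℝ))).trace.re := by
  rw [geomP_eq hA (hR.rpow _ _), rpow_rpow_of_isStrictlyPositive hR,
    show (-1 * -1 : ℝ) = 1 by norm_num, CFC.rpow_one R hR.nonneg, traceP]

lemma traceQ_eq {α z : ℝ} (hz : z ≠ 0) {A R : Matrix ι ι ℂ} (hA : IsStrictlyPositive A)
    (hR : IsStrictlyPositive R) : traceQ α z A R = (sandwichQ α z A (R ^ (-1 : ℝ))).trace.re := by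
  rw [trace_sandwichQ_eq hz hA (hR.rpow _ _), rpow_rpow_of_isStrictlyPositive hR,
    show (-1 * -1 : ℝ) = 1 by norm_num, CFC.rpow_one R hR.nonneg, traceQ]

/-- Since α - 1 > 0, continuity reaches singular R, the limit in which B = R⁻¹ no longer exists. -/
lemma continuousOn_traceP {α : ℝ} (hα : 1 < α) (A : Matrix ι ι ℂ) :
    ContinuousOn (traceP α A) {R | 0 ≤ R} := by
  refine continuousOn_trace_re ((continuousOn_const.mul ?_).mul continuousOn_const)
  exact (continuousOn_rpow_nonneg (sub_pos.mpr hα)).comp (by fun_prop)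
    fun R hR => rpow_conj_nonneg hR A (1 / 2)

lemma continuousOn_traceQ {α z : ℝ} (hα : 1 < α) (hz : 0 < z) (A : Matrix ι ι ℂ) :
    ContinuousOn (traceQ α z A) {R | 0 ≤ R} := by
  refine continuousOn_trace_re ((continuousOn_rpow_nonneg hz).comp ((continuousOn_const.mul
    (continuousOn_rpow_nonneg (div_pos (sub_pos.mpr hα) hz))).mul continuousOn_const) ?_)
  exact fun R _ => rpow_conj_nonneg (a := R ^ ((α - 1) / z)) CFC.rpow_nonneg A (α / (2 * z))

/-! ### Closed forms at a rank-one projection. -/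

section Projection

variable {E : Matrix ι ι ℂ}

lemma trace_conj_projection {ι : Type*} [Fintype ι] {E : Matrix ι ι ℂ} (hEE : E * E = E)
    (htr : E.trace = 1) {S : Matrix ι ι ℂ} {c : ℝ} (h : E * (S * S) * E = c • E) : (S * E * S).trace.re = c := by
  have : (S * E * S).trace = (E * (S * S) * E).trace := by
    rw [Matrix.trace_mul_comm (E * _), ← mul_assoc, hEE, Matrix.trace_mul_comm (S * E),
      ← mul_assoc, Matrix.trace_mul_comm]
  rw [this, h, Matrix.trace_smul, htr]
  simp

lemma trace_geomP_projection (hE : 0 ≤ E) (htr : E.trace = 1)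
    {B : Matrix ι ι ℂ} (hB : IsStrictlyPositive B) {α c : ℝ} (hα : 0 < α) (hc : 0 < c)
    (h : E * B ^ (-1 : ℝ) * E = c • E) : (geomP α E B).trace.re = c ^ (α - 1) := by
  have h2 : E * (B ^ (-(1 / 2) : ℝ) * B ^ (-(1 / 2) : ℝ)) * E = c • E := by
    rw [← CFC.rpow_add hB.isUnit, ← h]; norm_num
  rw [geomP, conj_projection_rpow hE (hB.rpow _ _).isSelfAdjoint hc h2 hα, mul_smul_comm,
    smul_mul_assoc, show B ^ (1 / 2 : ℝ) * (B ^ (-(1 / 2) : ℝ) * E * B ^ (-(1 / 2) : ℝ)) *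
      B ^ (1 / 2 : ℝ) = (B ^ (1 / 2 : ℝ) * B ^ (-(1 / 2) : ℝ)) * E *
      (B ^ (-(1 / 2) : ℝ) * B ^ (1 / 2 : ℝ)) by simp only [mul_assoc],
    CFC.rpow_mul_rpow_neg _ hB, CFC.rpow_neg_mul_rpow _ hB, one_mul, mul_one, Matrix.trace_smul,
    htr]
  simp

lemma trace_sandwichQ_projection (hE : 0 ≤ E) (hEE : E * E = E) (htr : E.trace = 1)
    {B : Matrix ι ι ℂ} (hB : IsStrictlyPositive B) {α z c : ℝ} (hα : 0 < α) (hz : 0 < z)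
    (hc : 0 < c) (h : E * B ^ ((1 - α) / z) * E = c • E) :
    (sandwichQ α z E B).trace.re = c ^ z := by
  have h2 : E * (B ^ ((1 - α) / (2 * z)) * B ^ ((1 - α) / (2 * z))) * E = c • E := by
    rw [← CFC.rpow_add hB.isUnit, ← h]
    congr 3; field_simp; ring
  rw [sandwichQ, rpow_eq_self_of_mul_self hE hEE (div_pos hα hz),
    conj_projection_rpow hE (hB.rpow _ _).isSelfAdjoint hc h2 hz, Matrix.trace_smul,
    Complex.smul_re, trace_conj_projection hEE htr h2, smul_eq_mul, Real.rpow_sub_one hc.ne',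
    div_mul_cancel₀ _ hc.ne']

lemma traceP_projection (hE : 0 ≤ E) (hEE : E * E = E) (htr : E.trace = 1)
    {A : Matrix ι ι ℂ} (hA : IsStrictlyPositive A) {α c c₂ : ℝ} (hα : 1 < α)
    (hc : 0 < c) (h : E * A * E = c • E) (h₂ : E * (A * A) * E = c₂ • E) :
    traceP α A E = c ^ (α - 2) * c₂ := by
  have hAA : A ^ (1 / 2 : ℝ) * A ^ (1 / 2 : ℝ) = A := by
    rw [← CFC.rpow_add hA.isUnit, add_halves, CFC.rpow_one A hA.nonneg]
  have h' : E * (A ^ (1 / 2 : ℝ) * A ^ (1 / 2 : ℝ)) * E = c • E := by rw [hAA, h]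
  rw [traceP, conj_projection_rpow hE (hA.rpow _ _).isSelfAdjoint hc h' (sub_pos.mpr hα),
    mul_smul_comm, smul_mul_assoc, show A ^ (1 / 2 : ℝ) * (A ^ (1 / 2 : ℝ) * E * A ^ (1 / 2 : ℝ)) *
      A ^ (1 / 2 : ℝ) = (A ^ (1 / 2 : ℝ) * A ^ (1 / 2 : ℝ)) * E *
      (A ^ (1 / 2 : ℝ) * A ^ (1 / 2 : ℝ)) by simp only [mul_assoc], hAA, Matrix.trace_smul,
    Complex.smul_re, trace_conj_projection hEE htr h₂, smul_eq_mul, sub_sub]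
  norm_num

lemma traceQ_projection (hE : 0 ≤ E) (hEE : E * E = E) (htr : E.trace = 1)
    {A : Matrix ι ι ℂ} (hA : IsStrictlyPositive A) {α z c : ℝ} (hα : 1 < α) (hz : 0 < z)
    (hc : 0 < c) (h : E * A ^ (α / z) * E = c • E) : traceQ α z A E = c ^ z := by
  have h2 : E * (A ^ (α / (2 * z)) * A ^ (α / (2 * z))) * E = c • E := by
    rw [← CFC.rpow_add hA.isUnit, ← h]
    congr 3; field_simp; ring
  rw [traceQ, rpow_eq_self_of_mul_self hE hEE (div_pos (sub_pos.mpr hα) hz),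
    conj_projection_rpow hE (hA.rpow _ _).isSelfAdjoint hc h2 hz, Matrix.trace_smul,
    Complex.smul_re, trace_conj_projection hEE htr h2, smul_eq_mul, Real.rpow_sub_one hc.ne',
    div_mul_cancel₀ _ hc.ne']

end Projection

lemma unitaryDiagonal_isStrictlyPositive (u : unitary (Matrix ι ι ℂ)) {d : ι → ℝ}
    (hd : ∀ i, 0 < d i) : IsStrictlyPositive (unitaryDiagonal u d) := by
  refine IsUnit.isStrictlyPositive ?_ (unitaryDiagonal_nonneg u fun i => (hd i).le)
  refine IsUnit.map (unitaryDiagonal u) (Pi.isUnit_iff.mpr fun i => ?_)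
  exact (hd i).ne'.isUnit

end Traces

/-! ### The 2 × 2 test matrices. -/

section TwoByTwo

open scoped Matrix.Norms.L2Operator

/-- The rank-one projection onto the span of `(√(1-q), √q)`. -/
noncomputable def proj₂ (q : ℝ) : Matrix (Fin 2) (Fin 2) ℂ :=
  !![((1 - q : ℝ) : ℂ), (√(q * (1 - q)) : ℂ); (√(q * (1 - q)) : ℂ), (q : ℂ)]

/-- The positive diagonal matrix `diag(1, t)`. -/
noncomputable def diag₂ (t : ℝ) : Matrix (Fin 2) (Fin 2) ℂ := unitaryDiagonal 1 ![1, t]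

lemma diag₂_eq (t : ℝ) : diag₂ t = !![1, 0; 0, (t : ℂ)] := by
  rw [diag₂, unitaryDiagonal_apply]
  ext i j
  fin_cases i <;> fin_cases j <;> simp

lemma diag₂_isStrictlyPositive {t : ℝ} (ht : 0 < t) : IsStrictlyPositive (diag₂ t) :=
  unitaryDiagonal_isStrictlyPositive _ fun i => by fin_cases i <;> simp [ht]

lemma diag₂_rpow {t : ℝ} (ht : 0 < t) (p : ℝ) : diag₂ t ^ p = diag₂ (t ^ p) := by
  rw [diag₂, unitaryDiagonal_rpow _ fun i => by fin_cases i <;> simp [ht.le], diag₂]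
  congr 1
  ext i
  fin_cases i <;> simp

variable {q : ℝ}

/-- The scalar is ⟨v, diag(1, t) v⟩ for v = (√(1-q), √q), a weighted mean of the eigenvalues. -/
lemma proj₂_conj_diag₂ (hq : 0 ≤ q) (hq1 : q ≤ 1) (t : ℝ) :
    proj₂ q * diag₂ t * proj₂ q = ((1 - q) + q * t) • proj₂ q := by
  have hs : (√(q * (1 - q)) : ℂ) * √(q * (1 - q)) = q * (1 - q) := by
    rw [← Complex.ofReal_mul, Real.mul_self_sqrt (mul_nonneg hq (by linarith))]
    push_cast; ring
  rw [diag₂_eq, proj₂]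
  generalize (√(q * (1 - q)) : ℂ) = s at *
  ext i j
  fin_cases i <;> fin_cases j <;> simp [Matrix.mul_apply, Fin.sum_univ_two] <;>
    first
    | linear_combination hs
    | linear_combination (t : ℂ) * hs
    | ring

lemma proj₂_mul_self (hq : 0 ≤ q) (hq1 : q ≤ 1) : proj₂ q * proj₂ q = proj₂ q := by
  have h := proj₂_conj_diag₂ hq hq1 1
  rwa [diag₂_eq, Complex.ofReal_one, ← Matrix.one_fin_two, mul_one, mul_one, sub_add_cancel,
    one_smul] at h

lemma proj₂_nonneg (hq : 0 ≤ q) (hq1 : q ≤ 1) : 0 ≤ proj₂ q := by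
  have h : star (proj₂ q) = proj₂ q := by
    ext i j
    fin_cases i <;> fin_cases j <;> simp [proj₂, Matrix.star_apply]
  rw [← proj₂_mul_self hq hq1]
  nth_rw 1 [← h]
  exact star_mul_self_nonneg _

lemma trace_proj₂ (q : ℝ) : (proj₂ q).trace = 1 := by
  simp [proj₂, Matrix.trace_fin_two]

end TwoByTwo

/-! ### Necessity of the parameter conditions. -/

section Necessity

/-- Strict convexity at 1 and 1/2, the eigenvalues of diag(1, 2)⁻¹, whose mean is 3/4. -/
lemma mean_rpow_lt_of_one_lt {s : ℝ} (hs : 1 < s) :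
    (3 / 4 : ℝ) ^ s < 1 / 2 + 1 / 2 * (1 / 2 : ℝ) ^ s := by
  have h := (strictConvexOn_rpow hs).2 (x := 1) (y := 1 / 2) (by simp) (by norm_num) (by norm_num)
    (show (0 : ℝ) < 1 / 2 by norm_num) (show (0 : ℝ) < 1 / 2 by norm_num) (by norm_num)
  simp only [smul_eq_mul, Real.one_rpow] at h
  norm_num at h ⊢
  linarith

lemma lt_mean_rpow_of_lt_one {s : ℝ} (hs0 : 0 < s) (hs : s < 1) :
    1 / 2 + 1 / 2 * (1 / 2 : ℝ) ^ s < (3 / 4 : ℝ) ^ s := by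
  have h := (Real.strictConcaveOn_rpow hs0 hs).2 (x := 1) (y := 1 / 2) (by simp) (by norm_num)
    (by norm_num) (show (0 : ℝ) < 1 / 2 by norm_num) (show (0 : ℝ) < 1 / 2 by norm_num)
    (by norm_num)
  simp only [smul_eq_mul, Real.one_rpow] at h
  norm_num at h ⊢
  linarith

/-- Since (3/4)² > 1/2, the square of the left side is below w = (1/2)^s, and w ≤ ((1 + w)/2)². -/
lemma mean_rpow_lt_of_neg {s : ℝ} (hs : s < 0) :
    (3 / 4 : ℝ) ^ s < 1 / 2 + 1 / 2 * (1 / 2 : ℝ) ^ s := by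
  have hw : 0 < (1 / 2 : ℝ) ^ s := by positivity
  have h1 : ((3 / 4 : ℝ) ^ s) ^ 2 < (1 / 2 : ℝ) ^ s := by
    rw [← Real.rpow_natCast, ← Real.rpow_mul (by norm_num), mul_comm, Real.rpow_mul (by norm_num)]
    exact Real.rpow_lt_rpow_of_neg (by norm_num) (by norm_num) hs
  refine lt_of_pow_lt_pow_left₀ 2 (by positivity) (h1.trans_le ?_)
  nlinarith [sq_nonneg (1 - (1 / 2 : ℝ) ^ s)]

open scoped Matrix.Norms.L2Operator

lemma trace_renyiP_proj₂ {α : ℝ} (hα : 0 < α) :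
    (renyiP α (proj₂ (1 / 2)) (diag₂ 2)).trace.re = (3 / 4 : ℝ) ^ (α - 1) := by
  refine trace_geomP_projection (proj₂_nonneg (by norm_num) (by norm_num))
    (trace_proj₂ _)
    (diag₂_isStrictlyPositive two_pos) hα (by norm_num) ?_
  have := diag₂_rpow two_pos (-1)
  refine (congrArg (fun X => proj₂ (1 / 2) * X * proj₂ (1 / 2)) this).trans ?_
  rw [proj₂_conj_diag₂ (by norm_num) (by norm_num), Real.rpow_neg_one]
  norm_num

lemma trace_renyiQ_proj₂ {α z : ℝ} (hα : 0 < α) (hz : 0 < z) :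
    (renyiQ α z (proj₂ (1 / 2)) (diag₂ 2)).trace.re =
      (1 / 2 + 1 / 2 * (1 / 2 : ℝ) ^ ((α - 1) / z)) ^ z := by
  refine trace_sandwichQ_projection (proj₂_nonneg (by norm_num) (by norm_num))
    (proj₂_mul_self (by norm_num) (by norm_num)) (trace_proj₂ _)
    (diag₂_isStrictlyPositive two_pos) hα hz (by positivity) ?_
  have := diag₂_rpow two_pos ((1 - α) / z)
  refine (congrArg (fun X => proj₂ (1 / 2) * X * proj₂ (1 / 2)) this).trans ?_
  rw [proj₂_conj_diag₂ (by norm_num) (by norm_num), show (1 - α) / z = -((α - 1) / z) by ring,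
    Real.rpow_neg two_pos.le, ← Real.inv_rpow two_pos.le]
  norm_num

lemma three_quarters_rpow {α z : ℝ} (hz : 0 < z) :
    (3 / 4 : ℝ) ^ (α - 1) = ((3 / 4 : ℝ) ^ ((α - 1) / z)) ^ z := by
  rw [← Real.rpow_mul (by norm_num), div_mul_cancel₀ _ hz.ne']

lemma traceP_proj₂ {α q t : ℝ} (hα : 1 < α) (hq : 0 ≤ q) (hq1 : q ≤ 1) (ht : 0 < t)
    (hc : 0 < 1 - q + q * t) : traceP α (diag₂ t) (proj₂ q) =
      (1 - q + q * t) ^ (α - 2) * (1 - q + q * t ^ (2 : ℝ)) := by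
  refine traceP_projection (proj₂_nonneg hq hq1) (proj₂_mul_self hq hq1) (trace_proj₂ _)
    (diag₂_isStrictlyPositive ht) hα hc (proj₂_conj_diag₂ hq hq1 t) ?_
  rw [← proj₂_conj_diag₂ hq hq1, diag₂_eq, diag₂_eq]
  congr 2
  ext i j
  fin_cases i <;> fin_cases j <;> simp [pow_two]

lemma traceQ_proj₂ {α z q t : ℝ} (hα : 1 < α) (hz : 0 < z) (hq : 0 ≤ q) (hq1 : q ≤ 1) (ht : 0 < t)
    (hc : 0 < 1 - q + q * t ^ (α / z)) : traceQ α z (diag₂ t) (proj₂ q) =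
      (1 - q + q * t ^ (α / z)) ^ z := by
  refine traceQ_projection (proj₂_nonneg hq hq1) (proj₂_mul_self hq hq1) (trace_proj₂ _)
    (diag₂_isStrictlyPositive ht) hα hz hc ?_
  refine (congrArg (fun X => proj₂ q * X * proj₂ q) (diag₂_rpow ht (α / z))).trans ?_
  exact proj₂_conj_diag₂ hq hq1 _

/-- For large `t`, the pair `(diag₂ t, proj₂ q)` with small weight `q` separates the traces. -/
lemma exists_traceQ_lt_traceP {α z : ℝ} (hα : 2 ≤ α) (hz : α / 2 < z) :
    ∃ A R : Matrix (Fin 2) (Fin 2) ℂ, IsStrictlyPositive A ∧ 0 ≤ R ∧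
      traceQ α z A R < traceP α A R := by
  have hz0 : 0 < z := by linarith
  have hx0 : 0 < α / z := div_pos (by linarith) hz0
  have hx : 0 < 2 - α / z := by rw [sub_pos, div_lt_iff₀ hz0]; linarith
  set x := α / z with hxdef
  -- With weight q = t^(-x) the trace of Q is at most 2^z, while q t² = t^(2-x), made equal to 2^z +
  -- 1 here, pushes the trace of P above it.
  set t : ℝ := ((2 : ℝ) ^ z + 1) ^ (1 / (2 - x)) with ht
  have h2z : 0 < (2 : ℝ) ^ z := by positivity
  have ht1 : 1 ≤ t := Real.one_le_rpow (by linarith) (by positivity)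
  have ht0 : 0 < t := by linarith
  have htx : t ^ (2 - x) = 2 ^ z + 1 := by
    rw [ht, ← Real.rpow_mul (by positivity), one_div_mul_cancel hx.ne', Real.rpow_one]
  have hq0 : 0 ≤ t ^ (-x) := by positivity
  have hq1 : t ^ (-x) ≤ 1 := Real.rpow_le_one_of_one_le_of_nonpos ht1 (by linarith)
  have e1 : t ^ (-x) * t ^ x = 1 := by rw [← Real.rpow_add ht0]; simp
  have e2 : t ^ (-x) * t ^ (2 : ℝ) = 2 ^ z + 1 := by
    rw [← Real.rpow_add ht0, ← htx]; congr 1; ring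
  have hc : 1 ≤ 1 - t ^ (-x) + t ^ (-x) * t := by nlinarith
  refine ⟨diag₂ t, proj₂ (t ^ (-x)), diag₂_isStrictlyPositive ht0, proj₂_nonneg hq0 hq1, ?_⟩
  rw [traceP_proj₂ (by linarith) hq0 hq1 ht0 (by linarith),
    traceQ_proj₂ (by linarith) hz0 hq0 hq1 ht0 (by rw [← hxdef, e1]; linarith), ← hxdef, e1, e2]
  calc (1 - t ^ (-x) + 1) ^ z ≤ 2 ^ z :=
        Real.rpow_le_rpow (by linarith) (by linarith) hz0.le
    _ < 1 * (1 - t ^ (-x) + (2 ^ z + 1)) := by linarith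
    _ ≤ _ := mul_le_mul_of_nonneg_right (Real.one_le_rpow hc (by linarith)) (by linarith)

/-- Now q = t⁻² keeps the trace of P at most 2, as α ≤ 2, while q t^(α/z) = t^(α/z-2) grows; t is
chosen so that the trace of Q is at least 3. -/
lemma exists_traceP_lt_traceQ {α z : ℝ} (hα1 : 1 < α) (hα : α ≤ 2) (hz0 : 0 < z) (hz : z < α / 2) :
    ∃ A R : Matrix (Fin 2) (Fin 2) ℂ, IsStrictlyPositive A ∧ 0 ≤ R ∧
      traceP α A R < traceQ α z A R := by
  have hx : 0 < α / z - 2 := by rw [sub_pos, lt_div_iff₀ hz0]; linarith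
  set x := α / z with hxdef
  set t : ℝ := ((3 : ℝ) ^ (1 / z)) ^ (1 / (x - 2)) with ht
  have h3 : 1 ≤ (3 : ℝ) ^ (1 / z) := Real.one_le_rpow (by norm_num) (by positivity)
  have ht1 : 1 ≤ t := Real.one_le_rpow h3 (by positivity)
  have ht0 : 0 < t := by linarith
  have htx : t ^ (x - 2) = 3 ^ (1 / z) := by
    rw [ht, ← Real.rpow_mul (by positivity), one_div_mul_cancel hx.ne', Real.rpow_one]
  have hq0 : 0 ≤ t ^ (-2 : ℝ) := by positivity
  have hq1 : t ^ (-2 : ℝ) ≤ 1 := Real.rpow_le_one_of_one_le_of_nonpos ht1 (by norm_num)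
  have e1 : t ^ (-2 : ℝ) * t ^ x = 3 ^ (1 / z) := by
    rw [← Real.rpow_add ht0, ← htx]; congr 1; ring
  have e2 : t ^ (-2 : ℝ) * t ^ (2 : ℝ) = 1 := by rw [← Real.rpow_add ht0]; simp
  have hc : 1 ≤ 1 - t ^ (-2 : ℝ) + t ^ (-2 : ℝ) * t := by nlinarith
  refine ⟨diag₂ t, proj₂ (t ^ (-2 : ℝ)), diag₂_isStrictlyPositive ht0, proj₂_nonneg hq0 hq1, ?_⟩
  rw [traceP_proj₂ hα1 hq0 hq1 ht0 (by linarith),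
    traceQ_proj₂ hα1 hz0 hq0 hq1 ht0 (by rw [← hxdef, e1]; linarith), ← hxdef, e1, e2]
  calc _ ≤ 1 * (1 - t ^ (-2 : ℝ) + 1) := mul_le_mul_of_nonneg_right
        (Real.rpow_le_one_of_one_le_of_nonpos hc (by linarith)) (by linarith)
    _ < 3 := by linarith
    _ = ((3 : ℝ) ^ (1 / z)) ^ z := by
        rw [← Real.rpow_mul (by norm_num), one_div_mul_cancel hz0.ne', Real.rpow_one]
    _ ≤ _ := Real.rpow_le_rpow (by positivity) (by linarith) hz0.le

variable {α z : ℝ}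

lemma le_min_of_trace_renyiP_le (hα : 0 < α) (hz : 0 < z) (hα1 : α ≠ 1)
    (h : ∀ A B : Matrix (Fin 2) (Fin 2) ℂ, A.PosDef → B.PosDef →
      (renyiP α A B).trace.re ≤ (renyiQ α z A B).trace.re) :
    (0 < α ∧ α < 1) ∨ (1 < α ∧ z ≤ min (α / 2) (α - 1)) := by
  have h' : ∀ A B : Matrix (Fin 2) (Fin 2) ℂ, IsStrictlyPositive A → IsStrictlyPositive B →
      (geomP α A B).trace.re ≤ (sandwichQ α z A B).trace.re := fun A B hA hB =>
    h A B (Matrix.isStrictlyPositive_iff_posDef.mp hA) (Matrix.isStrictlyPositive_iff_posDef.mp hB)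
  rcases hα1.lt_or_gt with h1 | h1
  · exact .inl ⟨hα, h1⟩
  have hz1 : z ≤ α - 1 := by
    by_contra! hlt
    have key : (renyiP α (proj₂ (1 / 2)) (diag₂ 2)).trace.re ≤
        (renyiQ α z (proj₂ (1 / 2)) (diag₂ 2)).trace.re :=
      le_of_le_on_isStrictlyPositive (continuousOn_trace_re_geomP hα (diag₂ 2))
        (continuousOn_trace_re_sandwichQ hα hz (diag₂ 2))
        (fun A hA => h' A _ hA (diag₂_isStrictlyPositive two_pos))
        (proj₂_nonneg (by norm_num) (by norm_num))
    rw [trace_renyiP_proj₂ hα, trace_renyiQ_proj₂ hα hz, three_quarters_rpow hz] at key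
    exact key.not_gt (Real.rpow_lt_rpow (by positivity) (lt_mean_rpow_of_lt_one
      (div_pos (by linarith) hz) (by rwa [div_lt_one hz])) hz)
  refine .inr ⟨h1, le_min ?_ hz1⟩
  by_contra! hlt
  -- α ≥ 2 follows from α/2 < z ≤ α - 1, so the bound by α - 1 had to come first.
  obtain ⟨A, R, hA, hR, hAR⟩ := exists_traceQ_lt_traceP (by linarith) hlt
  refine hAR.not_ge (le_of_le_on_isStrictlyPositive (continuousOn_traceP h1 A)
    (continuousOn_traceQ h1 hz A) (fun R hR => ?_) hR)
  rw [traceP_eq hA hR, traceQ_eq hz.ne' hA hR]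
  exact h' _ _ hA (hR.rpow _ _)

lemma max_le_of_trace_renyiQ_le (hα : 0 < α) (hz : 0 < z) (hα1 : α ≠ 1)
    (h : ∀ A B : Matrix (Fin 2) (Fin 2) ℂ, A.PosDef → B.PosDef →
      (renyiQ α z A B).trace.re ≤ (renyiP α A B).trace.re) :
    1 < α ∧ max (α / 2) (α - 1) ≤ z := by
  have h' : ∀ A B : Matrix (Fin 2) (Fin 2) ℂ, IsStrictlyPositive A → IsStrictlyPositive B →
      (sandwichQ α z A B).trace.re ≤ (geomP α A B).trace.re := fun A B hA hB =>
    h A B (Matrix.isStrictlyPositive_iff_posDef.mp hA) (Matrix.isStrictlyPositive_iff_posDef.mp hB)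
  have key : ¬ (3 / 4 : ℝ) ^ ((α - 1) / z) < 1 / 2 + 1 / 2 * (1 / 2 : ℝ) ^ ((α - 1) / z) := by
    intro hlt
    have key : (renyiQ α z (proj₂ (1 / 2)) (diag₂ 2)).trace.re ≤
        (renyiP α (proj₂ (1 / 2)) (diag₂ 2)).trace.re :=
      le_of_le_on_isStrictlyPositive (continuousOn_trace_re_sandwichQ hα hz (diag₂ 2))
        (continuousOn_trace_re_geomP hα (diag₂ 2))
        (fun A hA => h' A _ hA (diag₂_isStrictlyPositive two_pos))
        (proj₂_nonneg (by norm_num) (by norm_num))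
    rw [trace_renyiP_proj₂ hα, trace_renyiQ_proj₂ hα hz, three_quarters_rpow hz] at key
    exact key.not_gt (Real.rpow_lt_rpow (by positivity) hlt hz)
  rcases hα1.lt_or_gt with h1 | h1
  -- For α < 1 the exponent (α - 1)/z is negative, so the test pair excludes every z.
  · exact (key (mean_rpow_lt_of_neg (div_neg_of_neg_of_pos (by linarith) hz))).elim
  have hz1 : α - 1 ≤ z := by
    by_contra! hlt
    exact key (mean_rpow_lt_of_one_lt (by rwa [one_lt_div hz]))
  refine ⟨h1, max_le ?_ hz1⟩
  by_contra! hlt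
  -- α ≤ 2 follows from α - 1 ≤ z < α/2.
  obtain ⟨A, R, hA, hR, hAR⟩ := exists_traceP_lt_traceQ h1 (by linarith) hz hlt
  refine hAR.not_ge (le_of_le_on_isStrictlyPositive (continuousOn_traceQ h1 hz A)
    (continuousOn_traceP h1 A) (fun R hR => ?_) hR)
  rw [traceP_eq hA hR, traceQ_eq hz.ne' hA hR]
  exact h' _ _ hA (hR.rpow _ _)

end Necessity

theorem theorem4p1 (α z : ℝ) (hα : 0 < α) (hz : 0 < z) (hα1 : α ≠ 1) :
    List.TFAE
      [ ∀ (n : ℕ) (A B : Matrix (Fin n) (Fin n) ℂ), A.PosSemidef → B.PosDef →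
          LogMajorized (renyiP α A B) (renyiQ α z A B),
        ∀ (n : ℕ) (A B : Matrix (Fin n) (Fin n) ℂ), A.PosSemidef → B.PosDef →
          (renyiP α A B).trace.re ≤ (renyiQ α z A B).trace.re,
        ∀ A B : Matrix (Fin 2) (Fin 2) ℂ, A.PosDef → B.PosDef →
          LogMajorized (renyiP α A B) (renyiQ α z A B),
        (0 < α ∧ α < 1) ∨ (1 < α ∧ z ≤ min (α / 2) (α - 1)) ] ∧
    List.TFAE
      [ ∀ (n : ℕ) (A B : Matrix (Fin n) (Fin n) ℂ), A.PosSemidef → B.PosDef →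
          LogMajorized (renyiQ α z A B) (renyiP α A B),
        ∀ (n : ℕ) (A B : Matrix (Fin n) (Fin n) ℂ), A.PosSemidef → B.PosDef →
          (renyiQ α z A B).trace.re ≤ (renyiP α A B).trace.re,
        ∀ A B : Matrix (Fin 2) (Fin 2) ℂ, A.PosDef → B.PosDef →
          LogMajorized (renyiQ α z A B) (renyiP α A B),
        1 < α ∧ max (α / 2) (α - 1) ≤ z ] := by
  constructor
  · tfae_have 1 → 2 := fun h n A B hA hB => (h n A B hA hB).trace_re_le
    tfae_have 1 → 3 := fun h A B hA hB => h 2 A B hA.posSemidef hB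
    tfae_have 2 → 4 := fun h => le_min_of_trace_renyiP_le hα hz hα1 fun A B hA hB =>
      h 2 A B hA.posSemidef hB
    tfae_have 3 → 4 := fun h => le_min_of_trace_renyiP_le hα hz hα1 fun A B hA hB =>
      (h A B hA hB).trace_re_le
    tfae_have 4 → 1 := fun h n A B hA hB =>
      logMajorized_renyiP_renyiQ hα hz (h.imp And.right id) hA hB
    tfae_finish
  · tfae_have 1 → 2 := fun h n A B hA hB => (h n A B hA hB).trace_re_le
    tfae_have 1 → 3 := fun h A B hA hB => h 2 A B hA.posSemidef hB
    tfae_have 2 → 4 := fun h => max_le_of_trace_renyiQ_le hα hz hα1 fun A B hA hB =>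
      h 2 A B hA.posSemidef hB
    tfae_have 3 → 4 := fun h => max_le_of_trace_renyiQ_le hα hz hα1 fun A B hA hB =>
      (h A B hA hB).trace_re_le
    tfae_have 4 → 1 := fun h n A B hA hB => logMajorized_renyiQ_renyiP h.1 hz h.2 hA hB
    tfae_finish
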